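/- Let $n\ge 1$, $a\in\mathbb C^n$, $0<\rho<\infty$, and let $B=\{z\in\mathbb C^n: |z-a|<\rho\}$ be the open Euclidean ball. Let $\mathbb H=H^2(\mathbb C,B)$ be the space of analytic functions $h:B\to\mathbb C$ for which $|h|^2$ admits a harmonic majorant on $B\subset\mathbb C^n=\mathbb R^{2n}$. Let $R$ be either the algebra of complex polynomials in $z_1,\dots,z_n$ (regarded as functions on $B$) or the algebra $H^\infty(\mathbb C,B)$ of bounded analytic functions on $B$. For an analytic function $f$ on $B$ let $\operatorname{ord}(f)\in\{0,1,2,\dots\}\cup\{\infty\}$ be the order of the zero of $f$ at $a$, i.e. the least degree of a nonzero homogeneous term in the power series of $f$ around $a$ ($\infty$ if there is none), and let $R_1=\{r\in R:\operatorname{ord}(r)\ge 1\}$. Then: (1) For every $h\in\mathbb H$ the function $|h|^2$ has a least harmonic majorant $u_h$ on $B$, and $\mathbb H$ is a complex Hilbert space, under pointwise linear operations, with norm given by $\|h\|^2=u_h(a)$. (2) $\mathbb H$ is an analytic Hilbert module on $B$, with base point $a$, over the analytic algebra $R$. That is: - on $R$: $\operatorname{ord}(r)=0$ if $r$ is a unit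 of $R$; $\operatorname{ord}(r)=\infty$ iff $r=0$; $\operatorname{ord}(rs)\ge\operatorname{ord}(r)+\operatorname{ord}(s)$; $\operatorname{ord}(\lambda r)=\operatorname{ord}(r)$ for $0\ne\lambda\in\mathbb C$; $\operatorname{ord}(r+s)\ge\min(\operatorname{ord}(r),\operatorname{ord}(s))$; - $\mathbb H$ is an $R$-module under pointwise multiplication, and $h\mapsto rh$ is continuous on $\mathbb H$ for each $r\in R$; - on $\mathbb H$: $\operatorname{ord}(h)=\infty$ iff $h=0$; $\operatorname{ord}(rh)\ge\operatorname{ord}(r)+\operatorname{ord}(h)$; $\operatorname{ord}(\lambda h)=\operatorname{ord}(h)$ for $0\ne\lambda\in\mathbb C$; $\operatorname{ord}(h_1+h_2)\ge\min(\operatorname{ord}(h_1),\operatorname{ord}(h_2))$; and $\operatorname{ord}$ is upper semicontinuous on $\mathbb H$; - there is an open neighborhood $\Omega_a\subseteq B$ of $a$ such that every sequence converging in the norm of $\mathbb H$ converges to the same limit uniformly on the compact subsets of $\Omega_a$. (3) Consequently the closed invariant subspaces of $\mathbb H$ are described as follows. For a closed subspace $V$ of $\mathbb H$ and $k\ge 0$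 put $V_k=\{h\in V:\operatorname{ord}(h)\ge k\}$ and $W_k=V_k\ominus V_{k+1}$ (orthogonal complement of $V_{k+1}$ in $V_k$). Let $H_k$ be the space $W_k$ obtained for $V=\mathbb H$, and let $P_k$ be the orthogonal projection of $\mathbb H$ onto $H_k$. Call (the decomposition of) $V$ *$R_1$ inner* if for all $k,m\ge0$, $h\in W_k$, $g\in V$, $r\in R_1$ with $\operatorname{ord}(rh-g)>m$ one has $rh-g\perp W_m$; say that it has the *full projection property* if for all $k,m\ge0$, $r\in R_1$, $h\in W_k$, $g\in V$ with $\operatorname{ord}(rh-g)\ge m$ one has $P_m(rh-g)\in P_m(W_m)$. Then for every closed subspace $V$ of $\mathbb H$: - $R_1V\subseteq V$ if and only if $V$ is $R_1$ inner and has the full projection property; - $R_1V\subseteq V$ if and only if $rW_k\subseteq V$ for all $k\ge0$ and $r\in R_1$; - $RV\subseteq V$ (i.e. $V$ is an $R$-submodule) if and only if $V$ is $R_1$ inner and has the full projection property. -/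

import Mathlib

open Topology

/-! ### Valuation algebras and valuation Hilbert modules -/

/-- An analytic valuation on a commutative complex algebra `R` with identity. The set
`ℤ₊ ∪ {∞}` of values is `ℕ∞`. -/
structure AnalyticValuation (R : Type*) [CommRing R] [Algebra ℂ R] where
  ord : R → ℕ∞
  ord_unit : ∀ r : R, IsUnit r → ord r = 0
  ord_eq_top_iff : ∀ r : R, ord r = ⊤ ↔ r = 0
  ord_mul : ∀ r s : R, ord r + ord s ≤ ord (r * s)
  ord_smul : ∀ (c : ℂ) (r : R), c ≠ 0 → ord (c • r) = ord r
  ord_add : ∀ r s : R, min (ord r) (ord s) ≤ ord (r + s)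

/-- A Hilbert module valuation on the Hilbert module `H` over the valuation algebra `(R, vR)`.
`H` is a left Hilbert module over `R`: a Hilbert space with a compatible `R`-module structure
such that multiplication by each fixed `r : R` is continuous (`ContinuousConstSMul`). -/
structure HilbertModuleValuation {R : Type*} [CommRing R] [Algebra ℂ R]
    (vR : AnalyticValuation R) (H : Type*) [NormedAddCommGroup H] [InnerProductSpace ℂ H]
    [CompleteSpace H] [Module R H] [IsScalarTower ℂ R H] [ContinuousConstSMul R H] where
  ord : H → ℕ∞
  ord_eq_top_iff : ∀ h : H, ord h = ⊤ ↔ h = 0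
  ord_module_smul : ∀ (r : R) (h : H), vR.ord r + ord h ≤ ord (r • h)
  ord_smul : ∀ (c : ℂ) (h : H), c ≠ 0 → ord (c • h) = ord h
  ord_add : ∀ h₁ h₂ : H, min (ord h₁) (ord h₂) ≤ ord (h₁ + h₂)
  ord_usc : UpperSemicontinuous ord

namespace HilbertModuleValuation

variable {R : Type*} [CommRing R] [Algebra ℂ R] {vR : AnalyticValuation R}
  {H : Type*} [NormedAddCommGroup H] [InnerProductSpace ℂ H] [CompleteSpace H]
  [Module R H] [IsScalarTower ℂ R H] [ContinuousConstSMul R H]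

/-- The `k`-th term `V_k = {h ∈ V : ord h ≥ k}` of the valuation subspace series of `V`. -/
noncomputable def series (v : HilbertModuleValuation vR H) (V : Submodule ℂ H) (k : ℕ) : Submodule ℂ H where
  carrier := {h | h ∈ V ∧ (k : ℕ∞) ≤ v.ord h}
  zero_mem' := ⟨V.zero_mem, by rw [(v.ord_eq_top_iff 0).2 rfl]; exact le_top⟩
  add_mem' := fun ha hb => ⟨V.add_mem ha.1 hb.1, (le_min ha.2 hb.2).trans (v.ord_add _ _)⟩
  smul_mem' := by
    intro c h hh
    refine ⟨V.smul_mem c hh.1, ?_⟩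
    by_cases hc : c = 0
    · rw [hc, zero_smul, (v.ord_eq_top_iff 0).2 rfl]
      exact le_top
    · rw [v.ord_smul c h hc]
      exact hh.2

/-- The valuation homogeneous component `W_k = V_k ⊖ V_{k+1}` of `V`. -/
noncomputable def component (v : HilbertModuleValuation vR H) (V : Submodule ℂ H) (k : ℕ) : Submodule ℂ H :=
  v.series V k ⊓ (v.series V (k + 1))ᗮ

theorem isClosed_component_top (v : HilbertModuleValuation vR H) (k : ℕ) :
    IsClosed (v.component ⊤ k : Set H) := by
  have h1 : IsClosed (v.series ⊤ k : Set H) := by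
    have : (v.series ⊤ k : Set H) = v.ord ⁻¹' Set.Ici (k : ℕ∞) := by
      ext h
      change (h ∈ (⊤ : Submodule ℂ H) ∧ (k : ℕ∞) ≤ v.ord h) ↔ (k : ℕ∞) ≤ v.ord h
      simp
    rw [this]
    exact upperSemicontinuous_iff_isClosed_preimage.1 v.ord_usc _
  exact h1.inter (Submodule.isClosed_orthogonal _)

instance (v : HilbertModuleValuation vR H) (k : ℕ) :
    (v.component ⊤ k).HasOrthogonalProjection :=
  haveI : CompleteSpace (v.component ⊤ k) := (v.isClosed_component_top k).completeSpace_coe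
  inferInstance

/-- `P_k`, the orthogonal projection of `H` onto the valuation homogeneous component `H_k` of the
whole space `H`. -/
noncomputable def proj (v : HilbertModuleValuation vR H) (k : ℕ) : H →L[ℂ] H :=
  (v.component ⊤ k).starProjection

/-- `V` is `R₁` invariant, where `R₁ = {r ∈ R : ord r ≥ 1}`. -/
def IsR1Invariant (_v : HilbertModuleValuation vR H) (V : Submodule ℂ H) : Prop :=
  ∀ r : R, 1 ≤ vR.ord r → ∀ h ∈ V, r • h ∈ V

/-- `V` is `R` invariant, i.e. an `R` submodule. -/
def IsRInvariant (_v : HilbertModuleValuation vR H) (V : Submodule ℂ H) : Prop :=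
  ∀ r : R, ∀ h ∈ V, r • h ∈ V

/-- The valuation homogeneous decomposition of `V` is `R₁` inner. -/
def IsR1Inner (v : HilbertModuleValuation vR H) (V : Submodule ℂ H) : Prop :=
  ∀ k m : ℕ, ∀ h ∈ v.component V k, ∀ g ∈ V, ∀ r : R, 1 ≤ vR.ord r →
    (m : ℕ∞) < v.ord (r • h - g) → r • h - g ∈ (v.component V m)ᗮ

/-- The valuation homogeneous decomposition of `V` has the full projection property. -/
def HasFullProjection (v : HilbertModuleValuation vR H) (V : Submodule ℂ H) : Prop :=
  ∀ k m : ℕ, ∀ r : R, 1 ≤ vR.ord r → ∀ h ∈ v.component V k, ∀ g ∈ V,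
    (m : ℕ∞) ≤ v.ord (r • h - g) → ∃ w ∈ v.component V m, v.proj m (r • h - g) = v.proj m w

end HilbertModuleValuation

/-! ### Analytic functions on domains in `ℂⁿ`, and Hilbert spaces of functions -/

/-- A function on the open set `Ω ⊆ ℂⁿ` is analytic. -/
def IsAnalyticFun {n : ℕ} {Ω : TopologicalSpace.Opens (EuclideanSpace ℂ (Fin n))}
    (f : Ω → ℂ) : Prop :=
  AnalyticOnNhd ℂ (Function.extend Subtype.val f 0) Ω

/-- The order of the zero of `f` at `a ∈ Ω`: the least degree `k` of a homogeneous term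
`z ↦ p k (z - a, …, z - a)` which is not identically zero in the power series expansion `p` of `f`
around `a` (and `∞` if there is none). -/
noncomputable def zeroOrder {n : ℕ} {Ω : TopologicalSpace.Opens (EuclideanSpace ℂ (Fin n))}
    (a : Ω) (f : Ω → ℂ) : ℕ∞ :=
  ⨅ k ∈ {k : ℕ | ∃ p : FormalMultilinearSeries ℂ (EuclideanSpace ℂ (Fin n)) ℂ,
    HasFPowerSeriesAt (Function.extend Subtype.val f 0) p (a : EuclideanSpace ℂ (Fin n)) ∧
      ∃ w : EuclideanSpace ℂ (Fin n), p k (fun _ => w) ≠ 0}, (k : ℕ∞)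

/-- A complex Hilbert space of complex-valued functions on `X`: a linear space of functions, under
pointwise operations, with an inner product for which it is complete. -/
structure FunctionHilbertSpace (X : Type*) where
  carrier : Submodule ℂ (X → ℂ)
  core : InnerProductSpace.Core ℂ carrier
  /-- completeness for the norm `‖h‖ = √⟪h, h⟫` -/
  complete : @CompleteSpace carrier
    core.toNormedAddCommGroup.toMetricSpace.toPseudoMetricSpace.toUniformSpace

namespace FunctionHilbertSpace

variable {X : Type*}

/-- The elements of the function Hilbert space `𝓗`, as a type. (A type synonym of `𝓗.carrier`, so
that its topology is the one of the Hilbert space norm and not that of pointwise convergence.) -/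
def Elem (𝓗 : FunctionHilbertSpace X) : Type _ := 𝓗.carrier

noncomputable instance (𝓗 : FunctionHilbertSpace X) : NormedAddCommGroup 𝓗.Elem :=
  𝓗.core.toNormedAddCommGroup

noncomputable instance (𝓗 : FunctionHilbertSpace X) : InnerProductSpace ℂ 𝓗.Elem :=
  letI := 𝓗.core.toNormedAddCommGroup
  InnerProductSpace.ofCore 𝓗.core.toCore

instance (𝓗 : FunctionHilbertSpace X) : CompleteSpace 𝓗.Elem := 𝓗.complete

/-- The function underlying an element of `𝓗`. -/
def Elem.toFun {𝓗 : FunctionHilbertSpace X} (h : 𝓗.Elem) : X → ℂ := Subtype.val (h : 𝓗.carrier)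

end FunctionHilbertSpace

/-- For an algebra `R` and a Hilbert space `𝓗` of functions on `Ω`, with base point `a ∈ Ω`, a
Hilbert module structure of `𝓗` over `R` and valuations `vR`, `v`: `R` is an analytic algebra and
`𝓗` is an analytic Hilbert module on `Ω` over `R`. -/
structure IsAnalyticHilbertModule {n : ℕ} {Ω : TopologicalSpace.Opens (EuclideanSpace ℂ (Fin n))}
    (a : Ω) {R : Subalgebra ℂ (Ω → ℂ)} {𝓗 : FunctionHilbertSpace Ω}
    [Module R 𝓗.Elem] [IsScalarTower ℂ R 𝓗.Elem] [ContinuousConstSMul R 𝓗.Elem]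
    (vR : AnalyticValuation R) (v : HilbertModuleValuation vR 𝓗.Elem) : Prop where
  analytic_algebra : ∀ r : R, IsAnalyticFun (r : Ω → ℂ)
  analytic_space : ∀ h : 𝓗.Elem, IsAnalyticFun h.toFun
  /-- the order functions are the standard ones -/
  ord_algebra : ∀ r : R, vR.ord r = zeroOrder a (r : Ω → ℂ)
  ord_space : ∀ h : 𝓗.Elem, v.ord h = zeroOrder a h.toFun
  /-- the module operation is pointwise multiplication -/
  smul_pointwise : ∀ (r : R) (h : 𝓗.Elem) (z : Ω), (r • h).toFun z = (r : Ω → ℂ) z * h.toFun z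
  /-- near the base point, norm convergence implies uniform convergence on compact sets -/
  locally_compact_convergence : ∃ U : Set Ω, IsOpen U ∧ a ∈ U ∧
    ∀ (h : ℕ → 𝓗.Elem) (g : 𝓗.Elem), Filter.Tendsto h Filter.atTop (𝓝 g) →
      ∀ K ⊆ U, IsCompact K → TendstoUniformlyOn (fun j => (h j).toFun) g.toFun Filter.atTop K

/-! ### The algebras of polynomials and of bounded analytic functions -/

/-- The algebra of complex polynomials in `z₁, …, zₙ`, as functions on `Ω`. -/
noncomputable def polynomialAlgebra {n : ℕ}
    (Ω : TopologicalSpace.Opens (EuclideanSpace ℂ (Fin n))) : Subalgebra ℂ (Ω → ℂ) :=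
  (MvPolynomial.aeval (R := ℂ)
    (fun (i : Fin n) (z : Ω) => (z : EuclideanSpace ℂ (Fin n)) i)).range

section analyticLemmas

variable {n : ℕ} {Ω : TopologicalSpace.Opens (EuclideanSpace ℂ (Fin n))}

theorem isAnalyticFun_of_eqOn {f : Ω → ℂ} {F : EuclideanSpace ℂ (Fin n) → ℂ}
    (hF : AnalyticOnNhd ℂ F Ω) (h : ∀ z : Ω, F z = f z) : IsAnalyticFun f := by
  refine hF.congr Ω.isOpen ?_
  intro z hz
  rw [h ⟨z, hz⟩]
  exact (Subtype.val_injective.extend_apply f 0 ⟨z, hz⟩).symm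

theorem IsAnalyticFun.const (c : ℂ) : IsAnalyticFun (fun _ : Ω => c) :=
  isAnalyticFun_of_eqOn (F := fun _ => c) analyticOnNhd_const fun _ => rfl

theorem IsAnalyticFun.add {f g : Ω → ℂ} (hf : IsAnalyticFun f) (hg : IsAnalyticFun g) :
    IsAnalyticFun (f + g) :=
  isAnalyticFun_of_eqOn (AnalyticOnNhd.add hf hg) fun z => by simp

theorem IsAnalyticFun.mul {f g : Ω → ℂ} (hf : IsAnalyticFun f) (hg : IsAnalyticFun g) :
    IsAnalyticFun (f * g) :=
  isAnalyticFun_of_eqOn (AnalyticOnNhd.mul hf hg) fun z => by simp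

end analyticLemmas

/-- The algebra `H^∞` of bounded analytic functions on `Ω`. -/
def boundedAnalyticAlgebra {n : ℕ}
    (Ω : TopologicalSpace.Opens (EuclideanSpace ℂ (Fin n))) : Subalgebra ℂ (Ω → ℂ) where
  carrier := {f | IsAnalyticFun f ∧ ∃ C : ℝ, ∀ z, ‖f z‖ ≤ C}
  mul_mem' := by
    rintro f g ⟨hf, C, hC⟩ ⟨hg, D, hD⟩
    refine ⟨hf.mul hg, C * D, fun z => ?_⟩
    rw [Pi.mul_apply, norm_mul]
    exact mul_le_mul (hC z) (hD z) (norm_nonneg _) ((norm_nonneg _).trans (hC z))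
  add_mem' := by
    rintro f g ⟨hf, C, hC⟩ ⟨hg, D, hD⟩
    exact ⟨hf.add hg, C + D, fun z => (norm_add_le _ _).trans (add_le_add (hC z) (hD z))⟩
  algebraMap_mem' := fun c => ⟨IsAnalyticFun.const c, ‖c‖, fun _ => le_rfl⟩

/-! ### `H²` of a ball -/

/-- The open ball of radius `r` centred at `a` in `ℂⁿ`. -/
def openBall {n : ℕ} (a : EuclideanSpace ℂ (Fin n)) (r : ℝ) :
    TopologicalSpace.Opens (EuclideanSpace ℂ (Fin n)) :=
  ⟨Metric.ball a r, Metric.isOpen_ball⟩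

/-- `u` is harmonic on `Ω ⊆ ℂⁿ = ℝ²ⁿ` and `|h(z)|² ≤ u(z)` for all `z ∈ Ω`. Only the values of `u`
on `Ω` matter. -/
def IsHarmonicMajorant {n : ℕ} {Ω : TopologicalSpace.Opens (EuclideanSpace ℂ (Fin n))}
    (h : Ω → ℂ) (u : EuclideanSpace ℂ (Fin n) → ℝ) : Prop :=
  InnerProductSpace.HarmonicOnNhd u Ω ∧ ∀ z : Ω, ‖h z‖ ^ 2 ≤ u z

/-- `u` is the least harmonic majorant of `z ↦ |h(z)|²` on `Ω`. -/
def IsLeastHarmonicMajorant {n : ℕ} {Ω : TopologicalSpace.Opens (EuclideanSpace ℂ (Fin n))}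
    (h : Ω → ℂ) (u : EuclideanSpace ℂ (Fin n) → ℝ) : Prop :=
  IsHarmonicMajorant h u ∧ ∀ w, IsHarmonicMajorant h w → ∀ z : Ω, u z ≤ w z

/-- `H²(Ω)` as a linear space: the analytic functions `h` on `Ω` such that `|h|²` admits a harmonic
majorant. -/
def hardySpace {n : ℕ} (Ω : TopologicalSpace.Opens (EuclideanSpace ℂ (Fin n))) :
    Submodule ℂ (Ω → ℂ) where
  carrier := {h | IsAnalyticFun h ∧ ∃ u, IsHarmonicMajorant h u}
  zero_mem' := ⟨IsAnalyticFun.const 0, fun _ => 0,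
    InnerProductSpace.harmonicOnNhd_const 0, by simp⟩
  add_mem' := by
    rintro f g ⟨hf, u, hu, hfu⟩ ⟨hg, w, hw, hgw⟩
    refine ⟨hf.add hg, (2 : ℝ) • (u + w), (hu.add hw).const_smul, fun z => ?_⟩
    have h1 := hfu z
    have h2 := hgw z
    have h3 : ‖f z + g z‖ ^ 2 ≤ (‖f z‖ + ‖g z‖) ^ 2 := by
      gcongr
      exact norm_add_le _ _
    simp only [Pi.add_apply, Pi.smul_apply, smul_eq_mul]
    nlinarith [sq_nonneg (‖f z‖ - ‖g z‖)]
  smul_mem' := by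
    rintro c f ⟨hf, u, hu, hfu⟩
    refine ⟨(IsAnalyticFun.const c).mul hf, (‖c‖ ^ 2) • u, hu.const_smul, fun z => ?_⟩
    simp only [Pi.smul_apply, smul_eq_mul, norm_mul, mul_pow]
    exact mul_le_mul_of_nonneg_left (hfu z) (by positivity)

/-! ### The Laplacian along lines, and the maximum principle -/

section Laplacian

open InnerProductSpace Laplacian Filter

variable {E : Type*} [NormedAddCommGroup E] [InnerProductSpace ℝ E]
  {F : Type*} [NormedAddCommGroup F] [NormedSpace ℝ F]

/-! The analytic half rests on the Poisson kernel of the ball in real dimension `2 * n`. The kernel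
is treated as one function of `x` with values in the Banach algebra of continuous functions on the
sphere. It is harmonic in that sense (`harmonicOnNhd_poissonKernelMap`), so applying any continuous
functional to it yields a harmonic function. A maximum principle that needs no continuity at the
boundary then gives the Poisson formula (`HarmonicOnNhd.eq_poisson`).

For analytic `F` with bounded quadratic means over spheres of radius `t < ρ`, the functionals `g ↦ ∫
g |F(a + t z)|²` are bounded. Their limit `L` along an ultrafilter of radii tending to `ρ` replaces
a boundary measure, and `u z = L (P_{(z - a)/ρ})` is the least harmonic majorant: `|F|²` lies below
its Poisson integrals, while every harmonic majorant lies above them. At the center the kernel is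
`1`, so `u a` is the limit of the quadratic means. This makes `u a` the square of a norm coming from
an inner product, namely the limit of the sphere means of `conj F * G`. The estimate `u z ≤ ‖P‖ * u
a` bounds point evaluations uniformly on compact sets. Completeness, locally uniform convergence and
continuity of Taylor coefficients (hence semicontinuity of the order) follow from it by Cauchy
estimates.

The algebraic half holds in any valuation Hilbert module. A closed `V` is the closed span of its
mutually orthogonal components `W_k`, so invariance need only be tested on them. Given `h ∈ W_k` and
`ord r ≥ 1`, the full projection property allows `r h` to be approximated by `w₀ + ... + w_{m-1}`
with `w_i ∈ W_i` and an error of order at least `m`. Innerness makes each error orthogonal to the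
sum, so the sums are bounded and converge in `V`; the limiting error has infinite order and vanishes
(`smul_component_mem`). Finally `R = ℂ + R₁`, so invariance under `R` and under `R₁` agree. -/

theorem ContDiffAt.hasDerivAt_line {f : E → F} {x : E} (hf : ContDiffAt ℝ 2 f x) (v : E) :
    ∀ᶠ t in 𝓝 (0 : ℝ), HasDerivAt (fun t : ℝ => f (x + t • v)) (fderiv ℝ f (x + t • v) v) t := by
  have hc : Tendsto (fun t : ℝ => x + t • v) (𝓝 0) (𝓝 x) := by
    have : Continuous fun t : ℝ => x + t • v := by fun_prop
    simpa using this.tendsto 0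
  filter_upwards [hc.eventually (hf.eventually (by simp))] with t ht
  have h1 := (ht.differentiableAt (by simp)).hasFDerivAt
  have h2 : HasDerivAt (fun t : ℝ => x + t • v) v t := by
    simpa using ((hasDerivAt_id t).smul_const v).const_add x
  exact h1.comp_hasDerivAt t h2

theorem ContDiffAt.hasDerivAt_fderiv_line {f : E → F} {x : E} (hf : ContDiffAt ℝ 2 f x) (v : E) :
    HasDerivAt (fun t : ℝ => fderiv ℝ f (x + t • v) v) (iteratedFDeriv ℝ 2 f x ![v, v]) 0 := by
  have h0 : DifferentiableAt ℝ (fderiv ℝ f) x :=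
    (hf.fderiv_right (m := 1) (by norm_num)).differentiableAt (by simp)
  have h1 := h0.hasFDerivAt
  have h2 : HasDerivAt (fun t : ℝ => x + t • v) v 0 := by
    simpa using ((hasDerivAt_id (0 : ℝ)).smul_const v).const_add x
  have h3 : HasDerivAt (fun t : ℝ => fderiv ℝ f (x + t • v)) (fderiv ℝ (fderiv ℝ f) x v) 0 := by
    have h1' : HasFDerivAt (fderiv ℝ f) (fderiv ℝ (fderiv ℝ f) x) (x + (0 : ℝ) • v) := by
      simpa using h1
    exact h1'.comp_hasDerivAt 0 h2
  have h4 := h3.clm_apply (hasDerivAt_const (0 : ℝ) v)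
  simpa [iteratedFDeriv_two_apply] using h4

/-- The second derivative of `f` in the direction `v` can be computed along a line. -/
theorem ContDiffAt.iteratedFDeriv_two_eq_of_line {f : E → F} {x v : E} (hf : ContDiffAt ℝ 2 f x)
    {φ : ℝ → F} {c : F} (h1 : ∀ᶠ t in 𝓝 (0 : ℝ), HasDerivAt (fun t : ℝ => f (x + t • v)) (φ t) t)
    (h2 : HasDerivAt φ c 0) : iteratedFDeriv ℝ 2 f x ![v, v] = c := by
  have h : φ =ᶠ[𝓝 0] fun t : ℝ => fderiv ℝ f (x + t • v) v := by
    filter_upwards [h1, hf.hasDerivAt_line v] with t h h' using h.unique h'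
  exact (hf.hasDerivAt_fderiv_line v).unique (h2.congr_of_eventuallyEq h.symm)

/-- A positive second derivative at a critical point forces a local minimum along the line. Being
also a maximum, the restriction is locally constant, and its second derivative vanishes. -/
theorem ContDiffAt.iteratedFDeriv_two_nonpos_of_isLocalMax {f : E → ℝ} {x : E}
    (hf : ContDiffAt ℝ 2 f x) (hmax : IsLocalMax f x) (v : E) :
    iteratedFDeriv ℝ 2 f x ![v, v] ≤ 0 := by
  by_contra! hpos
  set φ : ℝ → ℝ := fun t => f (x + t • v)
  have hc : Tendsto (fun t : ℝ => x + t • v) (𝓝 0) (𝓝 x) := by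
    have : Continuous fun t : ℝ => x + t • v := by fun_prop
    simpa using this.tendsto 0
  have hφmax : IsLocalMax φ 0 := by
    have := hc.eventually hmax
    simpa [IsLocalMax, IsMaxFilter, φ] using this
  have hd : deriv φ =ᶠ[𝓝 0] fun t : ℝ => fderiv ℝ f (x + t • v) v := by
    filter_upwards [hf.hasDerivAt_line v] with t ht using ht.deriv
  have hdd : deriv (deriv φ) 0 = iteratedFDeriv ℝ 2 f x ![v, v] := by
    rw [hd.deriv_eq]
    exact (hf.hasDerivAt_fderiv_line v).deriv
  have hcont : ContinuousAt φ 0 := (hf.hasDerivAt_line v).self_of_nhds.continuousAt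
  have hφmin : IsLocalMin φ 0 :=
    isLocalMin_of_deriv_deriv_pos (hdd ▸ hpos) hφmax.deriv_eq_zero hcont
  have hconst : φ =ᶠ[𝓝 0] fun _ => φ 0 := by
    filter_upwards [hφmax, hφmin] with t h h' using le_antisymm h h'
  have h1 : deriv φ =ᶠ[𝓝 0] fun _ => 0 := by
    filter_upwards [hconst.eventuallyEq_nhds] with t ht
    rw [ht.deriv_eq]; simp
  rw [← hdd, h1.deriv_eq] at hpos
  simp at hpos

variable [FiniteDimensional ℝ E]

theorem laplacian_norm_sq (x : E) :
    Δ (fun y : E => ‖y‖ ^ 2) x = 2 * Module.finrank ℝ E := by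
  rw [laplacian_eq_iteratedFDeriv_stdOrthonormalBasis]
  have hv : ∀ i, iteratedFDeriv ℝ 2 (fun y : E => ‖y‖ ^ 2) x
      ![(stdOrthonormalBasis ℝ E) i, (stdOrthonormalBasis ℝ E) i] = 2 := by
    intro i
    set v := stdOrthonormalBasis ℝ E i
    have hv1 : ‖v‖ = 1 := (stdOrthonormalBasis ℝ E).orthonormal.1 i
    have hexp : (fun t : ℝ => ‖x + t • v‖ ^ 2) =
        fun t : ℝ => ‖x‖ ^ 2 + 2 * t * inner ℝ x v + t ^ 2 := by
      ext t
      rw [norm_add_sq_real, inner_smul_right, norm_smul, hv1]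
      simp; ring
    refine (contDiff_norm_sq ℝ).contDiffAt.iteratedFDeriv_two_eq_of_line
      (φ := fun t => 2 * inner ℝ x v + 2 * t) (Eventually.of_forall fun t => ?_) ?_
    · rw [hexp]
      have := (((hasDerivAt_id t).const_mul 2).mul_const (inner ℝ x v)).const_add (‖x‖ ^ 2)
      refine (this.add ((hasDerivAt_id t).pow 2)).congr_deriv ?_ |>.congr_of_eventuallyEq ?_
      · simp
      · exact Eventually.of_forall fun t => by simp
    · simpa using ((hasDerivAt_id (0 : ℝ)).const_mul 2).const_add (2 * inner ℝ x v)
  simp [hv, mul_comm]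

/-- Maximum principle for harmonic functions on the unit ball, without continuity up to the
boundary. -/
theorem InnerProductSpace.HarmonicOnNhd.nonpos_of_boundary [Nontrivial E] {u : E → ℝ}
    (hu : HarmonicOnNhd u (Metric.ball 0 1))
    (hb : ∀ ε > 0, ∃ r < 1, ∀ x, r ≤ ‖x‖ → ‖x‖ < 1 → u x ≤ ε) {x : E} (hx : ‖x‖ < 1) :
    u x ≤ 0 := by
  refine le_of_forall_pos_le_add fun ε hε => ?_
  obtain ⟨r₀, hr₀, hr⟩ := hb (ε / 2) (half_pos hε)
  obtain ⟨r, hr1, hr2⟩ := exists_between (max_lt hr₀ hx)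
  obtain ⟨hr0r, hxr⟩ := max_lt_iff.1 hr1
  -- The quadratic term makes the Laplacian strictly positive, so `v` has no interior maximum on a
  -- closed ball of radius `r < 1`. Its size is at most `ε / 2` there, which the other `ε / 2` for
  -- `u` leaves room for.
  set v : E → ℝ := fun y => u y + (ε / 2) * ‖y‖ ^ 2 with hv
  have hsub : Metric.closedBall (0 : E) r ⊆ Metric.ball 0 1 := Metric.closedBall_subset_ball hr2
  have hvc : ContinuousOn v (Metric.closedBall 0 r) :=
    (hu.continuousOn.mono hsub).add (by fun_prop)
  obtain ⟨y, hy, hymax⟩ := (isCompact_closedBall (0 : E) r).exists_isMaxOn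
    ⟨x, by simpa using hxr.le⟩ hvc
  rw [mem_closedBall_zero_iff] at hy
  have key : v y ≤ ε := by
    have hy1 : ‖y‖ < 1 := hy.trans_lt hr2
    rcases hy.lt_or_eq with h | h
    · exfalso
      have hlm : IsLocalMax v y :=
        hymax.isLocalMax (mem_of_superset (Metric.isOpen_ball.mem_nhds (by simpa using h))
          Metric.ball_subset_closedBall)
      have huy := hu y (by simpa using hy1)
      have hn : ContDiffAt ℝ 2 ((ε / 2) • fun y : E => ‖y‖ ^ 2) y :=
        ContDiffAt.const_smul (ε / 2) (contDiff_norm_sq ℝ).contDiffAt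
      have hveq : v = u + (ε / 2) • fun y : E => ‖y‖ ^ 2 := by ext; simp [v]
      have hvcd : ContDiffAt ℝ 2 v y := by rw [hveq]; exact huy.1.add hn
      have hlap : Δ v y = (ε / 2) * (2 * Module.finrank ℝ E) := by
        rw [hveq, huy.1.laplacian_add hn, huy.2.self_of_nhds,
          laplacian_smul _ (contDiff_norm_sq ℝ).contDiffAt, laplacian_norm_sq]
        simp
      have hle : Δ v y ≤ 0 := by
        rw [laplacian_eq_iteratedFDeriv_stdOrthonormalBasis]
        exact Finset.sum_nonpos fun i _ => hvcd.iteratedFDeriv_two_nonpos_of_isLocalMax hlm _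
      have hpos : (0 : ℝ) < Module.finrank ℝ E := by exact_mod_cast Module.finrank_pos
      rw [hlap] at hle
      exact absurd hle (not_le.2 (by positivity))
    · have h1 := hr y (by rw [h]; exact hr0r.le) hy1
      have : ‖y‖ ^ 2 ≤ 1 := pow_le_one₀ (norm_nonneg _) hy1.le
      simp only [hv]; nlinarith
  have hxy : v x ≤ v y := hymax (by simpa using hxr.le)
  have : u x ≤ v x := by simp only [hv]; nlinarith [sq_nonneg ‖x‖]
  linarith

theorem InnerProductSpace.HarmonicOnNhd.eq_zero_of_boundary [Nontrivial E] {u : E → ℝ}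
    (hu : HarmonicOnNhd u (Metric.ball 0 1))
    (hb : ∀ ε > 0, ∃ r < 1, ∀ x, r ≤ ‖x‖ → ‖x‖ < 1 → |u x| ≤ ε) {x : E} (hx : ‖x‖ < 1) :
    u x = 0 := by
  refine le_antisymm (hu.nonpos_of_boundary (fun ε hε => ?_) hx) ?_
  · obtain ⟨r, hr, h⟩ := hb ε hε
    exact ⟨r, hr, fun y h1 h2 => (le_abs_self _).trans (h y h1 h2)⟩
  · have := hu.neg.nonpos_of_boundary (fun ε hε => ?_) hx
    · simpa using this
    · obtain ⟨r, hr, h⟩ := hb ε hε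
      exact ⟨r, hr, fun y h1 h2 => (neg_le_abs _).trans (h y h1 h2)⟩

/-- Harmonicity is preserved by homotheties and translations. -/
theorem InnerProductSpace.HarmonicAt.comp_add_smul {f : E → F} {a x : E} {t : ℝ}
    (hf : HarmonicAt f (a + t • x)) : HarmonicAt (fun y => f (a + t • y)) x := by
  have hc : ContinuousAt (fun y => a + t • y) x := by fun_prop
  have haff : ContDiff ℝ 2 (fun y : E => a + t • y) := by fun_prop
  have hcd : ∀ y, HarmonicAt f (a + t • y) → ContDiffAt ℝ 2 (fun y => f (a + t • y)) y :=
    fun y hy => ContDiffAt.comp (f := fun y : E => a + t • y) y hy.1 haff.contDiffAt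
  refine ⟨hcd x hf, ?_⟩
  filter_upwards [hc.eventually hf.eventually] with y hy
  have hlap := hy.2.self_of_nhds
  rw [laplacian_eq_iteratedFDeriv_stdOrthonormalBasis] at hlap ⊢
  have : ∀ v, iteratedFDeriv ℝ 2 (fun y => f (a + t • y)) y ![v, v] =
      t ^ 2 • iteratedFDeriv ℝ 2 f (a + t • y) ![v, v] := by
    intro v
    have h1 := hy.1.hasDerivAt_line v
    have h2 := hy.1.hasDerivAt_fderiv_line v
    have hm : Tendsto (fun s : ℝ => t * s) (𝓝 0) (𝓝 0) := by
      simpa using (continuous_const_mul t).tendsto 0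
    have hd : ∀ s : ℝ, HasDerivAt (fun s : ℝ => t * s) t s := fun s => by
      simpa using (hasDerivAt_id s).const_mul t
    refine (hcd y hy).iteratedFDeriv_two_eq_of_line
      (φ := fun s => t • fderiv ℝ f (a + t • y + (t * s) • v) v) ?_ ?_
    · filter_upwards [hm.eventually h1] with s hs
      have := hs.scomp s (hd s)
      refine this.congr_of_eventuallyEq (Eventually.of_forall fun r => ?_)
      simp [smul_add, smul_smul, add_assoc]
    · have h2' : HasDerivAt (fun s : ℝ => fderiv ℝ f (a + t • y + s • v) v)
          (iteratedFDeriv ℝ 2 f (a + t • y) ![v, v]) (t * 0) := by simpa using h2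
      have := (h2'.scomp 0 (hd 0)).const_smul t
      rw [smul_smul, ← sq] at this
      exact this
  simp only [this]
  rw [← Finset.smul_sum]
  simpa using Or.inr hlap

end Laplacian

/-- Analytic functions of several complex variables are harmonic. -/
theorem AnalyticAt.harmonicAt_euclidean {n : ℕ} {f : EuclideanSpace ℂ (Fin n) → ℂ}
    {x : EuclideanSpace ℂ (Fin n)} (hf : AnalyticAt ℂ f x) : InnerProductSpace.HarmonicAt f x := by
  refine ⟨(hf.contDiffAt (n := 2)).restrict_scalars ℝ, ?_⟩
  filter_upwards [hf.eventually_analyticAt] with y hy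
  -- A real orthonormal basis made of pairs `e_j`, `i e_j`. In each pair the second derivatives
  -- cancel, since complex bilinearity contributes the factor `i² = -1`.
  let b : OrthonormalBasis ((_ : Fin n) × Fin 2) ℝ (EuclideanSpace ℂ (Fin n)) :=
    Pi.orthonormalBasis fun _ => Complex.orthonormalBasisOneI
  rw [InnerProductSpace.laplacian_eq_iteratedFDeriv_orthonormalBasis f b]
  have hr : ∀ v w, iteratedFDeriv ℝ 2 f y ![v, w] = iteratedFDeriv ℂ 2 f y ![v, w] := by
    intro v w
    rw [← (hy.contDiffAt (n := 2)).restrictScalars_iteratedFDeriv]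
    rfl
  have hI : ∀ v, iteratedFDeriv ℂ 2 f y ![Complex.I • v, Complex.I • v] =
      - iteratedFDeriv ℂ 2 f y ![v, v] := by
    intro v
    have := (iteratedFDeriv ℂ 2 f y).map_smul_univ (fun _ => Complex.I) ![v, v]
    simp only [Finset.prod_const, Finset.card_univ, Fintype.card_fin, Complex.I_sq] at this
    rw [← neg_one_smul ℂ, ← this]
    congr 1; ext i; fin_cases i <;> rfl
  have hb : ∀ i, b ⟨i, 1⟩ = Complex.I • b ⟨i, 0⟩ := by
    intro i
    ext j
    simp [b]
  simp only [hr, Fintype.sum_sigma, Fin.sum_univ_two, hb, hI]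
  simp

/-! ### The invariant mean on the unit sphere -/

section SphereMean

open MeasureTheory Metric Pointwise

section

variable {E : Type*} [NormedAddCommGroup E] [InnerProductSpace ℝ E]

/-- The action of a linear isometry on the unit sphere. -/
def LinearIsometryEquiv.onSphere (U : E ≃ₗᵢ[ℝ] E) (z : sphere (0 : E) 1) : sphere (0 : E) 1 :=
  ⟨U z, by simp⟩

theorem LinearIsometryEquiv.continuous_onSphere (U : E ≃ₗᵢ[ℝ] E) : Continuous U.onSphere :=
  (U.continuous.comp continuous_subtype_val).subtype_mk _

end

variable (E : Type*) [NormedAddCommGroup E] [InnerProductSpace ℝ E] [FiniteDimensional ℝ E]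
  [MeasurableSpace E] [BorelSpace E]

/-- The normalized surface measure on the unit sphere. -/
noncomputable def sphereMeasure : Measure (sphere (0 : E) 1) :=
  ((volume : Measure E).toSphere Set.univ)⁻¹ • (volume : Measure E).toSphere

instance [Nontrivial E] : IsProbabilityMeasure (sphereMeasure E) := by
  have : NeZero (volume : Measure E).toSphere := ⟨Measure.toSphere_ne_zero _⟩
  unfold sphereMeasure
  infer_instance

variable {E}

/-- The surface measure of a set is a constant times the volume of the cone over it. An isometry
maps cones to cones and preserves volume. -/
theorem measurePreserving_onSphere (U : E ≃ₗᵢ[ℝ] E) :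
    MeasurePreserving U.onSphere (sphereMeasure E) (sphereMeasure E) := by
  refine ⟨U.continuous_onSphere.measurable, ?_⟩
  have h : Measure.map U.onSphere (volume : Measure E).toSphere =
      (volume : Measure E).toSphere := by
    ext s hs
    rw [Measure.map_apply U.continuous_onSphere.measurable hs, Measure.toSphere_apply' _ hs,
      Measure.toSphere_apply' _ (U.continuous_onSphere.measurable hs)]
    congr 1
    have : Set.Ioo (0 : ℝ) 1 • (Subtype.val '' (U.onSphere ⁻¹' s)) =
        U ⁻¹' (Set.Ioo (0 : ℝ) 1 • (Subtype.val '' s)) := by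
      ext x
      simp only [Set.mem_smul, Set.mem_image, Set.mem_preimage]
      constructor
      · rintro ⟨t, ht, _, ⟨z, hz, rfl⟩, rfl⟩
        exact ⟨t, ht, U z, ⟨U.onSphere z, hz, rfl⟩, by simp⟩
      · rintro ⟨t, ht, _, ⟨z, hz, rfl⟩, h⟩
        refine ⟨t, ht, U.symm z, ⟨U.symm.onSphere z, ?_, rfl⟩, ?_⟩
        · convert hz using 1
          ext; simp [LinearIsometryEquiv.onSphere]
        · apply U.injective; simp [h]
    rw [this]
    exact U.measurePreserving.measure_preimage_equiv (f := U.toHomeomorph.toMeasurableEquiv) _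
  rw [sphereMeasure, Measure.map_smul, h]

variable (E) in
/-- The mean of a continuous function on the unit sphere. -/
noncomputable def sphereMean [Nontrivial E] : C(sphere (0 : E) 1, ℝ) →L[ℝ] ℝ :=
  LinearMap.mkContinuous
    { toFun := fun f => ∫ z, f z ∂(sphereMeasure E)
      map_add' := fun f g => integral_add
        (f.continuous.integrable_of_hasCompactSupport (HasCompactSupport.of_compactSpace _))
        (g.continuous.integrable_of_hasCompactSupport (HasCompactSupport.of_compactSpace _))
      map_smul' := fun c f => integral_const_mul c _ } 1 fun f => by
    have := norm_integral_le_of_norm_le_const (μ := sphereMeasure E)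
      (Filter.Eventually.of_forall fun z => f.norm_coe_le_norm z)
    simpa using this

variable [Nontrivial E]

theorem sphereMean_apply (f : C(sphere (0 : E) 1, ℝ)) :
    sphereMean E f = ∫ z, f z ∂(sphereMeasure E) := rfl

theorem sphereMean_one : sphereMean E 1 = 1 := by simp [sphereMean_apply]

theorem sphereMean_mono {f g : C(sphere (0 : E) 1, ℝ)} (h : ∀ z, f z ≤ g z) :
    sphereMean E f ≤ sphereMean E g :=
  integral_mono
    (f.continuous.integrable_of_hasCompactSupport (HasCompactSupport.of_compactSpace _))
    (g.continuous.integrable_of_hasCompactSupport (HasCompactSupport.of_compactSpace _)) h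

theorem sphereMean_onSphere (U : E ≃ₗᵢ[ℝ] E) {f g : C(sphere (0 : E) 1, ℝ)}
    (h : ∀ z, f z = g (U.onSphere z)) : sphereMean E f = sphereMean E g := by
  simp only [sphereMean_apply, h]
  have hU : MeasurableEmbedding U.onSphere :=
    (Homeomorph.mk ⟨U.onSphere, U.symm.onSphere,
      fun z => by ext; simp [LinearIsometryEquiv.onSphere],
      fun z => by ext; simp [LinearIsometryEquiv.onSphere]⟩ U.continuous_onSphere
      U.symm.continuous_onSphere).measurableEmbedding
  exact (measurePreserving_onSphere U).integral_comp hU _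

end SphereMean

/-! ### The Poisson kernel of the unit ball in even dimension -/

section Poisson

open InnerProductSpace Laplacian Filter Metric

theorem norm_sub_sphere_pos {E : Type*} [NormedAddCommGroup E] {x : E} (hx : ‖x‖ < 1)
    (z : sphere (0 : E) 1) : 0 < ‖x - z‖ := by
  rw [norm_pos_iff, sub_ne_zero]
  rintro rfl
  simp at hx

variable {E : Type*} [NormedAddCommGroup E] [InnerProductSpace ℝ E] [FiniteDimensional ℝ E]

variable (E) in
/-- `x` acts on the unit sphere as the function `z ↦ ⟪x, z⟫`. -/
noncomputable def sphereInner : E →L[ℝ] C(sphere (0 : E) 1, ℝ) :=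
  LinearMap.toContinuousLinearMap
    { toFun := fun x => ⟨fun z => inner ℝ x (z : E), by fun_prop⟩
      map_add' := fun x y => by ext z; simp [inner_add_left]
      map_smul' := fun c x => by ext z; simp [inner_smul_left] }

@[simp]
theorem sphereInner_apply (x : E) (z : sphere (0 : E) 1) :
    sphereInner E x z = inner ℝ x (z : E) := rfl

/-- The function `z ↦ ‖x - z‖²` on the unit sphere. -/
noncomputable def sphereDistSq (x : E) : C(sphere (0 : E) 1, ℝ) :=
  ‖x‖ ^ 2 • 1 - (2 : ℝ) • sphereInner E x + 1

theorem sphereDistSq_apply (x : E) (z : sphere (0 : E) 1) :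
    sphereDistSq x z = ‖x - z‖ ^ 2 := by
  rw [norm_sub_sq_real]
  simp [sphereDistSq]

/-- The Poisson kernel `z ↦ (1 - ‖x‖²) / ‖x - z‖ ^ (2 * m)` as a continuous function on the unit
sphere. -/
noncomputable def poissonKernelMap (m : ℕ) (x : E) : C(sphere (0 : E) 1, ℝ) :=
  (1 - ‖x‖ ^ 2) • (Ring.inverse (sphereDistSq x)) ^ m

theorem isUnit_sphereDistSq {x : E} (hx : ‖x‖ < 1) : IsUnit (sphereDistSq x) := by
  rw [ContinuousMap.isUnit_iff_forall_ne_zero]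
  intro z
  rw [sphereDistSq_apply]
  exact (pow_pos (norm_sub_sphere_pos hx z) 2).ne'

theorem poissonKernelMap_apply (m : ℕ) {x : E} (hx : ‖x‖ < 1) (z : sphere (0 : E) 1) :
    poissonKernelMap m x z = (1 - ‖x‖ ^ 2) * ((‖x - z‖ ^ 2)⁻¹) ^ m := by
  have h := Ring.mul_inverse_cancel _ (isUnit_sphereDistSq hx)
  have h1 := DFunLike.congr_fun h z
  rw [ContinuousMap.mul_apply, sphereDistSq_apply, ContinuousMap.one_apply] at h1
  simp only [poissonKernelMap, ContinuousMap.smul_apply, ContinuousMap.pow_apply, smul_eq_mul]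
  rw [eq_inv_of_mul_eq_one_right h1]

/-- Inversion in a Banach algebra is smooth at units, and `z ↦ ‖x - z‖²` is a unit depending
smoothly on `x`. This yields smoothness uniformly in `z`, with no differentiation under the integral
sign. -/
theorem contDiffAt_poissonKernelMap (m : ℕ) {x : E} (hx : ‖x‖ < 1) :
    ContDiffAt ℝ 2 (poissonKernelMap (E := E) m) x := by
  have h1 : ContDiff ℝ 2 (sphereDistSq (E := E)) := by
    unfold sphereDistSq
    exact (((contDiff_norm_sq (E := E) ℝ).smul contDiff_const).sub
      ((sphereInner E).contDiff.const_smul _)).add contDiff_const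
  have h2 : ContDiffAt ℝ 2 (fun x : E => Ring.inverse (sphereDistSq x)) x := by
    obtain ⟨v, hv⟩ := isUnit_sphereDistSq hx
    have h3 : ContDiffAt ℝ 2 Ring.inverse (sphereDistSq x) := hv ▸ contDiffAt_ringInverse ℝ v
    exact ContDiffAt.comp x h3 h1.contDiffAt
  exact (contDiffAt_const.sub (contDiff_norm_sq (E := E) ℝ).contDiffAt).smul (h2.pow m)

theorem hasDerivAt_inv_pow (m : ℕ) {q : ℝ → ℝ} {q' t : ℝ} (hq : HasDerivAt q q' t)
    (h0 : q t ≠ 0) : HasDerivAt (fun t => (q t)⁻¹ ^ m) (-(m * (q t)⁻¹ ^ (m + 1) * q')) t := by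
  rcases m with _ | m
  · simpa using hasDerivAt_const t (1 : ℝ)
  · refine ((hq.fun_inv h0).fun_pow (m + 1)).congr_deriv ?_
    have : (q t)⁻¹ ^ (m + 1 + 1) = (q t)⁻¹ ^ m / q t ^ 2 := by
      rw [div_eq_mul_inv, ← inv_pow]; ring
    rw [this, Nat.add_sub_cancel]
    ring

/-- The Laplacian is evaluated at each `z` separately. Second derivatives along basis vectors are
explicit, Parseval sums them, and the terms cancel exactly because the exponent `2 * m` equals the
real dimension. -/
theorem harmonicOnNhd_poissonKernelMap {m : ℕ} (hm : Module.finrank ℝ E = 2 * m) :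
    HarmonicOnNhd (poissonKernelMap (E := E) m) (ball 0 1) := by
  have key : ∀ x : E, ‖x‖ < 1 → Δ (poissonKernelMap (E := E) m) x = 0 := by
    intro x hx
    have hcd := contDiffAt_poissonKernelMap m hx
    ext z
    set ev := ContinuousMap.evalCLM (M := ℝ) ℝ z
    have h1 : Δ (poissonKernelMap (E := E) m) x z = Δ (ev ∘ poissonKernelMap (E := E) m) x :=
      (hcd.laplacian_CLM_comp_left (l := ev)).symm
    have hcd' : ContDiffAt ℝ 2 (ev ∘ poissonKernelMap (E := E) m) x :=
      hcd.continuousLinearMap_comp ev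
    rw [h1, laplacian_eq_iteratedFDeriv_stdOrthonormalBasis]
    set b := stdOrthonormalBasis ℝ E
    set y : E := x - z
    set q : ℝ := ‖y‖ ^ 2
    have hq : q ≠ 0 := (pow_pos (norm_sub_sphere_pos hx z) 2).ne'
    set A : ℝ := 1 - ‖x‖ ^ 2
    have hv : ∀ i, iteratedFDeriv ℝ 2 (ev ∘ poissonKernelMap (E := E) m) x ![b i, b i] =
        -2 * q⁻¹ ^ m + 8 * m * q⁻¹ ^ (m + 1) * (inner ℝ x (b i) * inner ℝ (b i) y)
          + A * (4 * m * (m + 1) * q⁻¹ ^ (m + 2) * (inner ℝ y (b i) * inner ℝ (b i) y)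
            - 2 * m * q⁻¹ ^ (m + 1)) := by
      intro i
      have hv1 : ‖b i‖ = 1 := b.orthonormal.1 i
      set α : ℝ := inner ℝ x (b i)
      set β : ℝ := inner ℝ (b i) y
      have hβ : inner ℝ y (b i) = β := real_inner_comm _ _
      set fA : ℝ → ℝ := fun t => A - 2 * t * α - t ^ 2
      set fQ : ℝ → ℝ := fun t => q + 2 * t * β + t ^ 2
      have hexpA : ∀ t : ℝ, 1 - ‖x + t • b i‖ ^ 2 = fA t := fun t => by
        rw [norm_add_sq_real, inner_smul_right, norm_smul, hv1]
        simp [fA, A, α]; ring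
      have hexpQ : ∀ t : ℝ, ‖x + t • b i - z‖ ^ 2 = fQ t := fun t => by
        have : x + t • b i - z = y + t • b i := by simp only [y]; abel
        rw [this, norm_add_sq_real, inner_smul_right, norm_smul, hv1, hβ]
        simp [fQ, q]; ring
      have hA' : ∀ t, HasDerivAt fA (-2 * α - 2 * t) t := fun t => by
        have := (((hasDerivAt_id t).const_mul 2).mul_const α).const_sub A
        refine (this.fun_sub ((hasDerivAt_id t).fun_pow 2)).congr_deriv ?_
        simp
      have hQ' : ∀ t, HasDerivAt fQ (2 * β + 2 * t) t := fun t => by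
        have := (((hasDerivAt_id t).const_mul 2).mul_const β).const_add q
        refine (this.fun_add ((hasDerivAt_id t).fun_pow 2)).congr_deriv ?_
        simp
      have hA'' : HasDerivAt (fun t : ℝ => -2 * α - 2 * t) (-2) 0 := by
        simpa using ((hasDerivAt_id (0 : ℝ)).const_mul 2).const_sub (-2 * α)
      have hQ'' : HasDerivAt (fun t : ℝ => 2 * β + 2 * t) 2 0 := by
        simpa using ((hasDerivAt_id (0 : ℝ)).const_mul 2).const_add (2 * β)
      have hcA : Continuous fun t : ℝ => x + t • b i := by fun_prop
      have hball : ∀ᶠ t in 𝓝 (0 : ℝ), ‖x + t • b i‖ < 1 :=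
        (hcA.norm.tendsto 0).eventually_lt_const (by simpa using hx)
      have hne : ∀ᶠ t in 𝓝 (0 : ℝ), fQ t ≠ 0 := by
        filter_upwards [hball] with t ht
        rw [← hexpQ]
        exact (pow_pos (norm_sub_sphere_pos ht z) 2).ne'
      have hform : ∀ᶠ t in 𝓝 (0 : ℝ), (ev ∘ poissonKernelMap (E := E) m) (x + t • b i) =
          fA t * (fQ t)⁻¹ ^ m := by
        filter_upwards [hball] with t ht
        rw [← hexpA, ← hexpQ]
        exact poissonKernelMap_apply m ht z
      refine hcd'.iteratedFDeriv_two_eq_of_line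
        (φ := fun t => (-2 * α - 2 * t) * (fQ t)⁻¹ ^ m +
          fA t * (-(m * (fQ t)⁻¹ ^ (m + 1) * (2 * β + 2 * t)))) ?_ ?_
      · filter_upwards [hform.eventually_nhds, hne] with t ht hne
        exact ((hA' t).fun_mul (hasDerivAt_inv_pow m (hQ' t) hne)).congr_of_eventuallyEq ht
      · have hQ0 : fQ 0 = q := by simp [fQ]
        have hA0 : fA 0 = A := by simp [fA]
        have hq0 : fQ 0 ≠ 0 := by rwa [hQ0]
        have d1 := hA''.fun_mul (hasDerivAt_inv_pow m (hQ' 0) hq0)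
        have d2 := (((hasDerivAt_inv_pow (m + 1) (hQ' 0) hq0).const_mul (m : ℝ)).fun_mul
          hQ'').fun_neg
        refine (d1.fun_add ((hA' 0).fun_mul d2)).congr_deriv ?_
        rw [hQ0, hA0, hβ]
        push_cast
        ring
    simp only [hv, Finset.sum_add_distrib, ← Finset.mul_sum, Finset.sum_sub_distrib,
      b.sum_inner_mul_inner, Finset.sum_const, Finset.card_univ, Fintype.card_fin, hm,
      real_inner_self_eq_norm_sq, nsmul_eq_mul]
    change _ = (0 : ℝ)
    -- The only use of `‖z‖ = 1`: with `z = x - y` it turns `1 - ‖x‖²` into `q - 2⟪x, y⟫`.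
    have hA : A = 2 * inner ℝ x y * (-1) + q := by
      have h1 : ‖(z : E)‖ = 1 := by simp
      have h2 : ‖(z : E)‖ ^ 2 = ‖x - y‖ ^ 2 := by simp [y]
      rw [norm_sub_sq_real, h1] at h2
      simp only [A, q]
      linarith
    change _ + A * (4 * m * (m + 1) * q⁻¹ ^ (m + 2) * q - _) = _
    rw [hA]
    have e1 : q⁻¹ ^ m = q⁻¹ ^ (m + 1) * q := by
      rw [pow_succ, mul_assoc, inv_mul_cancel₀ hq, mul_one]
    have e2 : q⁻¹ ^ (m + 2) * q = q⁻¹ ^ (m + 1) := by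
      rw [pow_succ _ (m + 1), mul_assoc, inv_mul_cancel₀ hq, mul_one]
    rw [mul_assoc (4 * (m : ℝ) * (m + 1)), e2, e1]
    push_cast
    ring
  intro x hx
  refine ⟨contDiffAt_poissonKernelMap m (by simpa using hx), ?_⟩
  filter_upwards [isOpen_ball.mem_nhds hx] with y hy using key y (by simpa using hy)

end Poisson

/-! ### Boundary values of Poisson integrals and the Poisson formula. -/

section PoissonRepresentation

open InnerProductSpace Laplacian Filter Metric

variable {E : Type*} [NormedAddCommGroup E] [InnerProductSpace ℝ E] [FiniteDimensional ℝ E]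

theorem poissonKernelMap_nonneg (m : ℕ) {x : E} (hx : ‖x‖ < 1) (z : sphere (0 : E) 1) :
    0 ≤ poissonKernelMap m x z := by
  rw [poissonKernelMap_apply m hx]
  have : ‖x‖ ^ 2 ≤ 1 := pow_le_one₀ (norm_nonneg _) hx.le
  have : 0 ≤ 1 - ‖x‖ ^ 2 := by linarith
  positivity

theorem poissonKernelMap_zero (m : ℕ) : poissonKernelMap (E := E) m 0 = 1 := by
  ext z
  rw [poissonKernelMap_apply m (by simp)]
  simp

theorem continuousOn_poissonKernelMap (m : ℕ) :
    ContinuousOn (poissonKernelMap (E := E) m) (ball 0 1) := fun x hx =>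
  (contDiffAt_poissonKernelMap m (by simpa using hx)).continuousAt.continuousWithinAt

theorem harmonicOnNhd_clm_poissonKernelMap {m : ℕ} (hm : Module.finrank ℝ E = 2 * m)
    (L : C(sphere (0 : E) 1, ℝ) →L[ℝ] ℝ) :
    HarmonicOnNhd (fun x => L (poissonKernelMap m x)) (ball 0 1) :=
  (harmonicOnNhd_poissonKernelMap hm).comp_CLM L

/-- Close points are handled by uniform continuity; for distant ones the oscillation `2 * ‖f‖` is
absorbed in the second term. The power `m` is chosen to cancel against the denominator of the
kernel. -/
theorem exists_forall_abs_sub_le_add_mul (m : ℕ) (f : C(sphere (0 : E) 1, ℝ)) {ε : ℝ}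
    (hε : 0 < ε) : ∃ C : ℝ, 0 ≤ C ∧ ∀ z w : sphere (0 : E) 1,
      |f z - f w| ≤ ε + C * (‖(z : E) - w‖ ^ 2) ^ m := by
  obtain ⟨δ, hδ, h⟩ := Metric.uniformContinuous_iff.1
    (CompactSpace.uniformContinuous_of_continuous f.continuous) ε hε
  refine ⟨2 * ‖f‖ / (δ ^ 2) ^ m, by positivity, fun z w => ?_⟩
  rcases lt_or_ge (dist z w) δ with hd | hd
  · have := (h hd).le
    rw [Real.dist_eq] at this
    have : 0 ≤ 2 * ‖f‖ / (δ ^ 2) ^ m * (‖(z : E) - w‖ ^ 2) ^ m := by positivity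
    linarith
  · have hd' : δ ≤ ‖(z : E) - w‖ := by rwa [Subtype.dist_eq, dist_eq_norm] at hd
    have h1 : |f z - f w| ≤ 2 * ‖f‖ := by
      have := abs_sub (f z) (f w)
      have h2 := f.norm_coe_le_norm z
      have h3 := f.norm_coe_le_norm w
      rw [Real.norm_eq_abs] at h2 h3
      linarith
    have h2 : (δ ^ 2) ^ m ≤ (‖(z : E) - w‖ ^ 2) ^ m := by gcongr
    have h3 : 2 * ‖f‖ ≤ 2 * ‖f‖ / (δ ^ 2) ^ m * (‖(z : E) - w‖ ^ 2) ^ m := by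
      rw [div_mul_eq_mul_div, le_div_iff₀ (by positivity)]
      gcongr
    linarith

variable [MeasurableSpace E] [BorelSpace E] [Nontrivial E]

/-- The mean is harmonic in `x` and, by invariance under reflections, radial. It is therefore
constant on each sphere, hence on the ball it bounds, and its value at the center is `1`. -/
theorem sphereMean_poissonKernelMap {m : ℕ} (hm : Module.finrank ℝ E = 2 * m) {x : E}
    (hx : ‖x‖ < 1) : sphereMean E (poissonKernelMap m x) = 1 := by
  set u : E → ℝ := fun x => sphereMean E (poissonKernelMap m x) with hu
  have hharm : HarmonicOnNhd u (ball 0 1) := harmonicOnNhd_clm_poissonKernelMap hm _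
  have hrad : ∀ y w : E, ‖y‖ < 1 → ‖y‖ = ‖w‖ → u y = u w := by
    intro y w hy hyw
    set U : E ≃ₗᵢ[ℝ] E := Submodule.reflection (ℝ ∙ (y - w))ᗮ
    have hU : U y = w := Submodule.reflection_sub hyw
    refine sphereMean_onSphere U fun z => ?_
    rw [poissonKernelMap_apply m hy, poissonKernelMap_apply m (hyw ▸ hy), hyw, ← hU]
    have : U y - (U.onSphere z : E) = U (y - z) := by
      simp [LinearIsometryEquiv.onSphere]
    rw [this, show ‖U (y - z)‖ = ‖y - z‖ from U.norm_map _]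
  have h0 : u 0 = 1 := by simp only [hu, poissonKernelMap_zero, sphereMean_one]
  -- Rescaling by `‖x‖` carries the unit sphere to the sphere through `x`, where the mean equals `u
  -- x`. So `v` tends to `0` at the boundary and must vanish at `0`, where it is `1 - u x`.
  set v : E → ℝ := (fun y => u (0 + ‖x‖ • y)) - fun _ => u x
  have hsm : ∀ y : E, ‖y‖ < 1 → ‖(0 : E) + ‖x‖ • y‖ < 1 := fun y hy => by
    rw [zero_add, norm_smul, norm_norm]
    exact (mul_le_of_le_one_left (norm_nonneg _) hx.le).trans_lt hy
  have hv : HarmonicOnNhd v (ball 0 1) := by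
    refine HarmonicOnNhd.sub (fun y hy => ?_) (harmonicOnNhd_const _)
    exact HarmonicAt.comp_add_smul (hharm _ (by simpa using hsm y (by simpa using hy)))
  have hv0 := hv.eq_zero_of_boundary (x := 0) (fun ε hε => ?_) (by simp)
  · simp only [v, Pi.sub_apply, smul_zero, add_zero, h0] at hv0
    change u x = 1
    linarith
  · have hc : ContinuousAt (fun s : ℝ => u (s • x)) 1 := by
      have : ContinuousAt u ((1 : ℝ) • x) := by
        rw [one_smul]; exact (hharm x (by simpa using hx)).1.continuousAt
      exact ContinuousAt.comp (f := fun s : ℝ => s • x) this (by fun_prop)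
    obtain ⟨δ, hδ, h⟩ := Metric.continuousAt_iff.1 hc ε hε
    refine ⟨max (1 - δ / 2) 0, max_lt (by linarith) one_pos, fun y hy1 hy2 => ?_⟩
    have hy3 : 1 - δ / 2 ≤ ‖y‖ := (le_max_left _ _).trans hy1
    have h1 : dist ‖y‖ 1 < δ := by
      rw [Real.dist_eq, abs_sub_comm, abs_of_pos (by linarith)]; linarith
    have h2 := h h1
    rw [one_smul, Real.dist_eq] at h2
    have h3 : u (0 + ‖x‖ • y) = u (‖y‖ • x) :=
      hrad _ _ (hsm y hy2) (by simp [norm_smul, mul_comm])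
    simp only [v, Pi.sub_apply, h3]
    exact h2.le

/-- The Poisson integral of `f` has boundary values `f`. -/
theorem exists_abs_poisson_sub_le {m : ℕ} (hm : Module.finrank ℝ E = 2 * m)
    (f : C(sphere (0 : E) 1, ℝ)) {ε : ℝ} (hε : 0 < ε) :
    ∃ r < 1, ∀ x : E, r ≤ ‖x‖ → ‖x‖ < 1 → ∀ w : sphere (0 : E) 1, x = ‖x‖ • (w : E) →
      |sphereMean E (poissonKernelMap m x * f) - f w| ≤ ε := by
  obtain ⟨C, hC, hf⟩ := exists_forall_abs_sub_le_add_mul m f (half_pos hε)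
  have hlim : Tendsto (fun r : ℝ => C * (4 ^ m * (1 - r ^ 2))) (𝓝[<] 1) (𝓝 0) := by
    have : Continuous fun r : ℝ => C * (4 ^ m * (1 - r ^ 2)) := by fun_prop
    simpa using (this.tendsto 1).mono_left nhdsWithin_le_nhds
  obtain ⟨r, hr0, hr, hr1⟩ := ((hlim.eventually_lt_const (half_pos hε)).and
    (Ioo_mem_nhdsLT (show (0 : ℝ) < 1 by norm_num))).exists
  refine ⟨r, hr1, fun x hrx hx w hxw => ?_⟩
  have hx0 : 0 ≤ ‖x‖ := norm_nonneg x
  set P := poissonKernelMap m x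
  have hP : sphereMean E P = 1 := sphereMean_poissonKernelMap hm hx
  -- A pointwise majorant of the kernel times the oscillation of `f` about `w`. Since the kernel has
  -- mean `1`, the mean of `K` is at most `ε` once `‖x‖ ≥ r`.
  set K : C(sphere (0 : E) 1, ℝ) := (ε / 2) • P + (C * (4 ^ m * (1 - ‖x‖ ^ 2))) • 1
  have hK : sphereMean E K = ε / 2 + C * (4 ^ m * (1 - ‖x‖ ^ 2)) := by
    simp [K, hP, sphereMean_one]
  have hKε : sphereMean E K ≤ ε := by
    rw [hK]
    have : C * (4 ^ m * (1 - ‖x‖ ^ 2)) ≤ C * (4 ^ m * (1 - r ^ 2)) := by gcongr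
    linarith
  have hdiff : sphereMean E (P * f) - f w = sphereMean E (P * f - f w • P) := by
    simp [hP]
  have hpt : ∀ z, |(P * f - f w • P) z| ≤ K z := by
    intro z
    have hP0 : 0 ≤ P z := poissonKernelMap_nonneg m hx z
    have h1 : (P * f - f w • P) z = P z * (f z - f w) := by
      simp; ring
    rw [h1, abs_mul, abs_of_nonneg hP0]
    -- The radial projection `w` is a nearest point of the sphere to `x`, so `‖z - w‖ ≤ 2 * ‖x -
    -- z‖`. The singular denominator cancels, leaving `4 ^ m * (1 - ‖x‖²)`.
    have h2 : P z * (‖(z : E) - w‖ ^ 2) ^ m ≤ 4 ^ m * (1 - ‖x‖ ^ 2) := by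
      have hd := norm_sub_sphere_pos hx z
      have hd1 : ‖x - (w : E)‖ = 1 - ‖x‖ := by
        have : x - (w : E) = -((1 - ‖x‖) • (w : E)) := by
          rw [sub_smul, one_smul, ← hxw]; abel
        rw [this, norm_neg, norm_smul, Real.norm_of_nonneg (by linarith)]
        simp
      have hd2 : 1 - ‖x‖ ≤ ‖x - (z : E)‖ := by
        have := norm_sub_norm_le (z : E) x
        rw [norm_sub_rev, show ‖(z : E)‖ = 1 by simp] at this
        exact this
      have hd3 : ‖(z : E) - w‖ ≤ 2 * ‖x - (z : E)‖ := by
        have : (z : E) - w = (x - w) - (x - z) := by abel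
        rw [this]
        refine (norm_sub_le _ _).trans ?_
        rw [hd1]; linarith
      have hd4 : (‖(z : E) - w‖ ^ 2) ^ m ≤ (4 * ‖x - (z : E)‖ ^ 2) ^ m := by
        gcongr
        calc ‖(z : E) - w‖ ^ 2 ≤ (2 * ‖x - (z : E)‖) ^ 2 := by gcongr
          _ = _ := by ring
      calc P z * (‖(z : E) - w‖ ^ 2) ^ m ≤ P z * (4 * ‖x - (z : E)‖ ^ 2) ^ m := by gcongr
        _ = 4 ^ m * (1 - ‖x‖ ^ 2) * ((‖x - (z : E)‖ ^ 2)⁻¹ ^ m * (‖x - (z : E)‖ ^ 2) ^ m) := by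
          rw [show P z = _ from poissonKernelMap_apply m hx z, mul_pow]; ring
        _ = _ := by rw [← mul_pow, inv_mul_cancel₀ (by positivity), one_pow, mul_one]
    calc P z * |f z - f w| ≤ P z * (ε / 2 + C * (‖(z : E) - w‖ ^ 2) ^ m) := by
          gcongr; exact hf z w
      _ = ε / 2 * P z + C * (P z * (‖(z : E) - w‖ ^ 2) ^ m) := by ring
      _ ≤ ε / 2 * P z + C * (4 ^ m * (1 - ‖x‖ ^ 2)) := by gcongr
      _ = K z := by simp [K]
  rw [hdiff, abs_le]
  constructor
  · have := sphereMean_mono (f := -K) (g := P * f - f w • P) fun z => by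
      simpa using (abs_le.1 (hpt z)).1
    rw [map_neg] at this
    linarith
  · exact (sphereMean_mono fun z => (abs_le.1 (hpt z)).2).trans hKε

/-- The Poisson formula on the unit ball. -/
theorem InnerProductSpace.HarmonicOnNhd.eq_poisson {m : ℕ} (hm : Module.finrank ℝ E = 2 * m)
    {w : E → ℝ} (hw : HarmonicOnNhd w (ball 0 1)) (hwc : ContinuousOn w (closedBall 0 1))
    {f : C(sphere (0 : E) 1, ℝ)} (hf : ∀ z, f z = w z) {x : E} (hx : ‖x‖ < 1) :
    w x = sphereMean E (poissonKernelMap m x * f) := by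
  -- Absorbing `f` into a functional makes the Poisson integral harmonic by harmonicity of the
  -- vector-valued kernel.
  set L : C(sphere (0 : E) 1, ℝ) →L[ℝ] ℝ :=
    (sphereMean E).comp ((ContinuousLinearMap.mul ℝ C(sphere (0 : E) 1, ℝ)).flip f)
  have hL : ∀ g, L g = sphereMean E (g * f) := fun g => rfl
  have hh := (harmonicOnNhd_clm_poissonKernelMap hm L).sub hw
  have h0 := hh.eq_zero_of_boundary (fun ε hε => ?_) hx
  · simp only [Pi.sub_apply, hL] at h0
    linarith
  · obtain ⟨r₁, hr₁, h1⟩ := exists_abs_poisson_sub_le hm f (half_pos hε)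
    obtain ⟨δ, hδ, h2⟩ := Metric.uniformContinuousOn_iff.1
      ((isCompact_closedBall (0 : E) 1).uniformContinuousOn_of_continuous hwc) (ε / 2) (half_pos hε)
    -- The bound `1 - δ / 2` puts `y` within `δ` of its radial projection, and `1 / 2` keeps `y`
    -- nonzero so that this projection exists.
    refine ⟨max r₁ (max (1 - δ / 2) (1 / 2)),
      max_lt hr₁ (max_lt (by linarith) (by norm_num)), fun y hy hy1 => ?_⟩
    have hy2 := (le_max_left _ _).trans hy
    have hy3 := ((le_max_left _ _).trans (le_max_right _ _)).trans hy
    have hy4 := ((le_max_right _ _).trans (le_max_right _ _)).trans hy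
    have hy0 : ‖y‖ ≠ 0 := by linarith
    set z : sphere (0 : E) 1 := ⟨‖y‖⁻¹ • y, by simp [norm_smul, hy0]⟩
    have hz : y = ‖y‖ • (z : E) := by simp [z, smul_smul, hy0]
    have e1 := h1 y hy2 hy1 z hz
    have hdist : dist (z : E) y < δ := by
      have : (z : E) - y = (1 - ‖y‖) • (z : E) := by rw [sub_smul, one_smul, ← hz]
      rw [dist_eq_norm, this, norm_smul, Real.norm_of_nonneg (by linarith)]
      simp; linarith
    have e2 := h2 z (by simp) y (by simpa using hy1.le) hdist
    rw [Real.dist_eq, ← hf] at e2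
    simp only [Pi.sub_apply, hL]
    calc |sphereMean E (poissonKernelMap m y * f) - w y|
        ≤ |sphereMean E (poissonKernelMap m y * f) - f z| + |f z - w y| := abs_sub_le _ _ _
      _ ≤ ε := by linarith

/-- Jensen's inequality for the probability density `P`: integrate `2 w(x) w(z) - w(x)² ≤ w(z)²`
against `P`. -/
theorem InnerProductSpace.HarmonicOnNhd.sq_le_poisson {m : ℕ} (hm : Module.finrank ℝ E = 2 * m)
    {w : E → ℝ} (hw : HarmonicOnNhd w (ball 0 1)) (hwc : ContinuousOn w (closedBall 0 1))
    {f : C(sphere (0 : E) 1, ℝ)} (hf : ∀ z : sphere (0 : E) 1, w z ^ 2 ≤ f z) {x : E} (hx : ‖x‖ < 1) :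
    w x ^ 2 ≤ sphereMean E (poissonKernelMap m x * f) := by
  set g : C(sphere (0 : E) 1, ℝ) := ⟨fun z => w z, by
    refine hwc.comp_continuous continuous_subtype_val fun z => ?_
    simp⟩
  have hg := hw.eq_poisson hm hwc (f := g) (fun _ => rfl) hx
  set P := poissonKernelMap m x
  have hP : sphereMean E P = 1 := sphereMean_poissonKernelMap hm hx
  have h1 : sphereMean E ((2 * w x) • (P * g) - (w x ^ 2) • P) = w x ^ 2 := by
    rw [map_sub, map_smul, map_smul, ← hg, hP, smul_eq_mul, smul_eq_mul]
    ring
  rw [← h1]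
  refine sphereMean_mono fun z => ?_
  have hP0 : 0 ≤ P z := poissonKernelMap_nonneg m hx z
  have := hf z
  change 2 * w x * (P z * w z) - w x ^ 2 * P z ≤ P z * f z
  nlinarith [mul_nonneg hP0 (sq_nonneg (w z - w x)), mul_le_mul_of_nonneg_left this hP0]

end PoissonRepresentation

/-! ### Locally uniform limits of analytic functions -/

section AnalyticLimits

open Filter Metric

universe u

/-- The one-variable Cauchy estimate on the complex line `ζ ↦ x + ζ • v`, on the disc of radius `δ /
‖v‖`. -/
theorem norm_fderiv_le_of_closedBall_subset {E F : Type*} [NormedAddCommGroup E] [NormedSpace ℂ E]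
    [NormedAddCommGroup F] [NormedSpace ℂ F] {f : E → F} {U : Set E} (hU : IsOpen U)
    (hf : DifferentiableOn ℂ f U) {x : E} {δ C : ℝ} (hδ : 0 < δ) (hsub : closedBall x δ ⊆ U)
    (hC : ∀ y ∈ closedBall x δ, ‖f y‖ ≤ C) : ‖fderiv ℂ f x‖ ≤ C / δ := by
  have hC0 : 0 ≤ C := (norm_nonneg _).trans (hC x (mem_closedBall_self hδ.le))
  refine ContinuousLinearMap.opNorm_le_bound _ (by positivity) fun v => ?_
  rcases eq_or_ne v 0 with rfl | hv
  · simp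
  have hv0 : 0 < ‖v‖ := norm_pos_iff.2 hv
  have hmem : ∀ ζ ∈ closedBall (0 : ℂ) (δ / ‖v‖), x + ζ • v ∈ closedBall x δ := by
    intro ζ hζ
    rw [mem_closedBall_zero_iff, le_div_iff₀ hv0] at hζ
    rwa [mem_closedBall_iff_norm, add_sub_cancel_left, norm_smul]
  have hd : ∀ ζ ∈ closedBall (0 : ℂ) (δ / ‖v‖),
      HasDerivAt (fun ζ : ℂ => f (x + ζ • v)) (fderiv ℂ f (x + ζ • v) v) ζ := by
    intro ζ hζ
    have h1 := (hf.differentiableAt (hU.mem_nhds (hsub (hmem ζ hζ)))).hasFDerivAt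
    have h2 : HasDerivAt (fun ζ : ℂ => x + ζ • v) v ζ := by
      simpa using ((hasDerivAt_id ζ).smul_const v).const_add x
    exact h1.comp_hasDerivAt ζ h2
  have hR : 0 < δ / ‖v‖ := by positivity
  have hdiff : DiffContOnCl ℂ (fun ζ : ℂ => f (x + ζ • v)) (ball 0 (δ / ‖v‖)) := by
    refine DifferentiableOn.diffContOnCl fun ζ hζ => ?_
    rw [closure_ball _ hR.ne'] at hζ
    exact (hd ζ hζ).differentiableAt.differentiableWithinAt
  have h := Complex.norm_deriv_le_of_forall_mem_sphere_norm_le hR hdiff (C := C) fun ζ hζ =>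
    hC _ (hmem ζ (sphere_subset_closedBall hζ))
  rw [(hd 0 (mem_closedBall_self hR.le)).deriv] at h
  simp only [zero_smul, add_zero] at h
  refine h.trans (le_of_eq ?_)
  field_simp

/-- Each differentiation costs one Cauchy estimate with radius `δ`, so `k` of them use a ball of
radius `k * δ`. -/
theorem norm_iteratedFDeriv_le_of_closedBall_subset {E : Type*} {F : Type*}
    [NormedAddCommGroup E] [NormedSpace ℂ E] [NormedAddCommGroup F] [NormedSpace ℂ F]
    {f : E → F} {U : Set E} (hU : IsOpen U) (hf : ∀ k : ℕ, ContDiffOn ℂ k f U) {δ C : ℝ}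
    (hδ : 0 < δ) (k : ℕ) : ∀ {x : E}, closedBall x (k * δ) ⊆ U →
      (∀ y ∈ closedBall x (k * δ), ‖f y‖ ≤ C) → ‖iteratedFDeriv ℂ k f x‖ ≤ C / δ ^ k := by
  induction k with
  | zero =>
    intro x _ hC
    simpa using hC x (by simp)
  | succ k ih =>
    intro x hsub hC
    have hk : (((k + 1 : ℕ) : ℝ)) * δ = k * δ + δ := by push_cast; ring
    rw [hk] at hsub hC
    have hk0 : 0 ≤ k * δ := by positivity
    have hincl : ∀ y ∈ closedBall x δ, closedBall y (k * δ) ⊆ closedBall x (k * δ + δ) := by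
      intro y hy
      refine closedBall_subset_closedBall' ?_
      have := mem_closedBall.1 hy
      linarith
    rw [← norm_fderiv_iteratedFDeriv, pow_succ, ← div_div]
    refine norm_fderiv_le_of_closedBall_subset (f := iteratedFDeriv ℂ k f) hU ?_ hδ
      ((closedBall_subset_closedBall (by linarith)).trans hsub) fun y hy =>
        ih ((hincl y hy).trans hsub) fun w hw => hC w (hincl y hy hw)
    intro y hy
    exact (((hf (k + 1)).contDiffAt (hU.mem_nhds hy)).differentiableAt_iteratedFDeriv
      (by exact_mod_cast k.lt_succ_self)).differentiableWithinAt

theorem iteratedDeriv_line {E F : Type*} [NormedAddCommGroup E] [NormedSpace ℂ E]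
    [NormedAddCommGroup F] [NormedSpace ℂ F] {f : E → F} {U : Set E} (hU : IsOpen U)
    (hf : ∀ k : ℕ, ContDiffOn ℂ k f U) (x y : E) (k : ℕ) : ∀ {ζ : ℂ}, x + ζ • y ∈ U →
      iteratedDeriv k (fun ζ : ℂ => f (x + ζ • y)) ζ =
        iteratedFDeriv ℂ k f (x + ζ • y) (fun _ => y) := by
  induction k with
  | zero => intro ζ _; simp
  | succ k ih =>
    intro ζ hζ
    have hc : Continuous fun ζ : ℂ => x + ζ • y := by fun_prop
    have hev : iteratedDeriv k (fun ζ : ℂ => f (x + ζ • y)) =ᶠ[𝓝 ζ]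
        fun ζ => iteratedFDeriv ℂ k f (x + ζ • y) (fun _ => y) := by
      filter_upwards [hc.continuousAt.preimage_mem_nhds (hU.mem_nhds hζ)] with w hw using ih hw
    rw [iteratedDeriv_succ, hev.deriv_eq]
    have h1 := (((hf (k + 1)).contDiffAt (hU.mem_nhds hζ)).differentiableAt_iteratedFDeriv
      (m := k) (by exact_mod_cast k.lt_succ_self)).hasFDerivAt
    have h2 : HasDerivAt (fun ζ : ℂ => x + ζ • y) y ζ := by
      simpa using ((hasDerivAt_id ζ).smul_const y).const_add x
    have h3 := h1.comp_hasDerivAt ζ h2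
    have h4 := (ContinuousMultilinearMap.apply ℂ (fun _ : Fin k => E) F
      (fun _ => y)).hasFDerivAt.comp_hasDerivAt ζ h3
    exact h4.deriv

/-- A complex smooth function is analytic. -/
theorem analyticOnNhd_of_forall_contDiffOn {E F : Type*} [NormedAddCommGroup E] [NormedSpace ℂ E]
    [NormedAddCommGroup F] [NormedSpace ℂ F] [CompleteSpace F] {f : E → F} {U : Set E}
    (hU : IsOpen U) (hf : ∀ k : ℕ, ContDiffOn ℂ k f U) : AnalyticOnNhd ℂ f U := by
  intro x hx
  have hcont : ContinuousAt f x := ((hf 0).continuousOn).continuousAt (hU.mem_nhds hx)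
  obtain ⟨R₁, hR₁, h1⟩ := Metric.isOpen_iff.1 hU x hx
  obtain ⟨R₂, hR₂, h2⟩ := Metric.eventually_nhds_iff_ball.1
    (hcont.norm.eventually_le_const (lt_add_one ‖f x‖))
  set C := ‖f x‖ + 1
  obtain ⟨R, hR, hRlt⟩ := exists_between (lt_min hR₁ hR₂)
  obtain ⟨hRR₁, hRR₂⟩ := lt_min_iff.1 hRlt
  have hsub : closedBall x R ⊆ U := (closedBall_subset_ball hRR₁).trans h1
  have hC : ∀ y ∈ closedBall x R, ‖f y‖ ≤ C := fun y hy => h2 y (closedBall_subset_ball hRR₂ hy)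
  have hC0 : 0 ≤ C := by positivity
  -- The choice `δ = R / k` lets the `k` Cauchy steps exactly exhaust the ball of radius `R`.
  have hbound : ∀ k : ℕ, ‖iteratedFDeriv ℂ k f x‖ * R ^ k ≤ C * k ^ k := by
    intro k
    rcases Nat.eq_zero_or_pos k with rfl | hk
    · simpa using hC x (mem_closedBall_self hR.le)
    · have hk' : (0 : ℝ) < k := by exact_mod_cast hk
      have hkR : k * (R / k) = R := by field_simp
      have := norm_iteratedFDeriv_le_of_closedBall_subset hU hf (δ := R / k) (C := C)
        (by positivity) k (x := x) (by rwa [hkR]) (by rwa [hkR])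
      rw [div_pow, div_div_eq_mul_div, le_div_iff₀ (by positivity)] at this
      exact this
  set p : FormalMultilinearSeries ℂ E F := fun k => (k.factorial : ℂ)⁻¹ • iteratedFDeriv ℂ k f x
  have he : 0 < Real.exp 1 := Real.exp_pos 1
  -- The loss of `e` in the radius compensates `k ^ k ≤ e ^ k * k!`.
  set r : NNReal := ⟨R / Real.exp 1, by positivity⟩
  have hr : (r : ℝ) = R / Real.exp 1 := rfl
  have hrpos : 0 < (r : ℝ) := by rw [hr]; positivity
  have hrR : (r : ℝ) ≤ R := by
    rw [hr]
    exact div_le_self hR.le (Real.one_le_exp zero_le_one)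
  refine ⟨p, r, ⟨p.le_radius_of_bound C fun k => ?_, by exact_mod_cast hrpos, fun {y} hy => ?_⟩⟩
  · have h3 : (k : ℝ) ^ k ≤ Real.exp 1 ^ k * k.factorial := by
      have := Real.pow_div_factorial_le_exp (x := k) (by positivity) k
      rw [div_le_iff₀ (by positivity)] at this
      rwa [← Real.exp_nat_mul, mul_one]
    have h4 : ‖p k‖ = (k.factorial : ℝ)⁻¹ * ‖iteratedFDeriv ℂ k f x‖ := by
      simp [p, norm_smul]
    rw [h4, hr, div_pow]
    have h5 := (hbound k).trans (mul_le_mul_of_nonneg_left h3 hC0)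
    calc (k.factorial : ℝ)⁻¹ * ‖iteratedFDeriv ℂ k f x‖ * (R ^ k / Real.exp 1 ^ k)
        = (‖iteratedFDeriv ℂ k f x‖ * R ^ k) / (Real.exp 1 ^ k * k.factorial) := by
          field_simp
      _ ≤ C := by rw [div_le_iff₀ (by positivity)]; exact h5
  · have hy' : ‖y‖ < R := by
      rw [Metric.eball_coe, mem_ball_zero_iff] at hy
      exact hy.trans_le hrR
    rcases eq_or_ne y 0 with rfl | hy0
    · have : HasSum (fun k => p k fun _ => (0 : E)) (p 0 fun _ => 0) :=
        hasSum_single 0 fun k hk => by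
          have : Nonempty (Fin k) := ⟨⟨0, Nat.pos_of_ne_zero hk⟩⟩
          exact (p k).map_coord_zero (Classical.arbitrary (Fin k)) rfl
      simpa [p] using this
    · have hyp : 0 < ‖y‖ := norm_pos_iff.2 hy0
      have hmem : ∀ ζ ∈ ball (0 : ℂ) (R / ‖y‖), x + ζ • y ∈ U := by
        intro ζ hζ
        rw [mem_ball_zero_iff, lt_div_iff₀ hyp] at hζ
        refine hsub ?_
        rw [mem_closedBall_iff_norm, add_sub_cancel_left, norm_smul]
        exact hζ.le
      -- The sum of the series at `y` is the one-variable Taylor expansion along the line through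
      -- `x` and `x + y`, evaluated at `ζ = 1`.
      have hd : DifferentiableOn ℂ (fun ζ : ℂ => f (x + ζ • y)) (ball 0 (R / ‖y‖)) := by
        intro ζ hζ
        have h3 := ((hf 1).differentiableOn (by simp)).differentiableAt
          (hU.mem_nhds (hmem ζ hζ))
        exact (DifferentiableAt.comp (f := fun ζ : ℂ => x + ζ • y) ζ h3
          (by fun_prop)).differentiableWithinAt
      have h1mem : (1 : ℂ) ∈ ball (0 : ℂ) (R / ‖y‖) := by
        rw [mem_ball_zero_iff, norm_one, lt_div_iff₀ hyp, one_mul]; exact hy'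
      have hs := Complex.hasSum_taylorSeries_on_ball hd h1mem
      have hx0 : x + (0 : ℂ) • y ∈ U := by simpa using hx
      simpa [p, iteratedDeriv_line hU hf x y _ hx0] using hs

/-- Cauchy estimates applied to `f i - f j` on slightly smaller balls make the derivatives locally
uniformly Cauchy; their limit is then the derivative of `g`. -/
theorem TendstoLocallyUniformlyOn.fderiv_complex {E F : Type*} [NormedAddCommGroup E]
    [NormedSpace ℂ E] [LocallyCompactSpace E] [NormedAddCommGroup F] [NormedSpace ℂ F] [CompleteSpace F]
    {f : ℕ → E → F} {g : E → F} {U : Set E} (hU : IsOpen U)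
    (hf : ∀ i, DifferentiableOn ℂ (f i) U) (h : TendstoLocallyUniformlyOn f g atTop U) :
    DifferentiableOn ℂ g U ∧
      TendstoLocallyUniformlyOn (fun i => fderiv ℂ (f i)) (fderiv ℂ g) atTop U := by
  have hloc : ∀ x ∈ U, ∃ t ∈ 𝓝 x, UniformCauchySeqOn (fun i => fderiv ℂ (f i)) atTop t := by
    intro x hx
    obtain ⟨t, ht, htU, htc⟩ := local_compact_nhds (hU.mem_nhds hx)
    have htu := (tendstoLocallyUniformlyOn_iff_forall_isCompact hU).1 h t htU htc
    obtain ⟨δ, hδ, hball⟩ := Metric.mem_nhds_iff.1 (inter_mem ht (hU.mem_nhds hx))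
    have hδ4 : 0 < δ / 4 := by positivity
    refine ⟨ball x (δ / 4), ball_mem_nhds x hδ4, ?_⟩
    have hcs := htu.uniformCauchySeqOn
    rw [Metric.uniformCauchySeqOn_iff] at hcs ⊢
    intro ε hε
    obtain ⟨N, hN⟩ := hcs (ε / 2 * (δ / 4)) (by positivity)
    refine ⟨N, fun i hi j hj y hy => ?_⟩
    have hsub : closedBall y (δ / 4) ⊆ ball x δ := closedBall_subset_ball' (by
      have := mem_ball.1 hy; linarith)
    have hyU : y ∈ U := (hball (hsub (mem_closedBall_self hδ4.le))).2
    have := norm_fderiv_le_of_closedBall_subset hU ((hf i).sub (hf j)) hδ4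
      (fun w hw => (hball (hsub hw)).2) (C := ε / 2 * (δ / 4)) fun w hw => by
        have := (hN i hi j hj w (hball (hsub hw)).1).le
        rwa [dist_eq_norm] at this
    rw [fderiv_sub ((hf i).differentiableAt (hU.mem_nhds hyU))
      ((hf j).differentiableAt (hU.mem_nhds hyU)), mul_div_cancel_right₀ _ hδ4.ne'] at this
    rw [dist_eq_norm]
    linarith
  have hlim : ∀ x, ∃ l, x ∈ U → Tendsto (fun i => fderiv ℂ (f i) x) atTop (𝓝 l) := by
    intro x
    by_cases hx : x ∈ U
    · obtain ⟨t, ht, hc⟩ := hloc x hx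
      obtain ⟨l, hl⟩ := cauchySeq_tendsto_of_complete (hc.cauchySeq (mem_of_mem_nhds ht))
      exact ⟨l, fun _ => hl⟩
    · exact ⟨0, fun h => absurd h hx⟩
  choose g' hg' using hlim
  have hunif : TendstoLocallyUniformlyOn (fun i => fderiv ℂ (f i)) g' atTop U := by
    intro u hu x hx
    obtain ⟨t, ht, hc⟩ := hloc x hx
    have hc' := (hc.mono (Set.inter_subset_left (t := U))).tendstoUniformlyOn_of_tendsto
      fun y hy => hg' y hy.2
    exact ⟨t ∩ U, inter_mem (mem_nhdsWithin_of_mem_nhds ht) self_mem_nhdsWithin, hc' u hu⟩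
  have hder : ∀ x ∈ U, HasFDerivAt g (g' x) x := fun x hx =>
    hasFDerivAt_of_tendstoLocallyUniformlyOn hU hunif
      (fun i y hy => ((hf i).differentiableAt (hU.mem_nhds hy)).hasFDerivAt)
      (fun y hy => h.tendsto_at hy) hx
  exact ⟨fun x hx => (hder x hx).differentiableAt.differentiableWithinAt,
    hunif.congr_right fun x hx => (hder x hx).fderiv.symm⟩

/-- Induction on `k` through the derivatives. The target space changes from `F` to `E →L[ℂ] F` at
each step, so `F` is quantified inside the induction and shares the universe of `E`. -/
theorem TendstoLocallyUniformlyOn.contDiffOn_complex {E : Type u} [NormedAddCommGroup E]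
    [NormedSpace ℂ E] [LocallyCompactSpace E] {U : Set E} (hU : IsOpen U) (k : ℕ) :
    ∀ {F : Type u} [NormedAddCommGroup F] [NormedSpace ℂ F] [CompleteSpace F]
      {f : ℕ → E → F} {g : E → F}, (∀ i, AnalyticOnNhd ℂ (f i) U) →
      TendstoLocallyUniformlyOn f g atTop U → ContDiffOn ℂ k g U := by
  induction k with
  | zero =>
    intro F _ _ _ f g hf h
    exact contDiffOn_zero.2 (h.continuousOn (Frequently.of_forall fun i => (hf i).continuousOn))
  | succ k ih =>
    intro F _ _ _ f g hf h
    obtain ⟨h1, h2⟩ := h.fderiv_complex hU fun i => (hf i).differentiableOn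
    have := ih (fun i => (hf i).fderiv) h2
    push_cast
    rw [contDiffOn_succ_iff_fderiv_of_isOpen hU]
    exact ⟨h1, by simp, this⟩

/-- A locally uniform limit of analytic functions is analytic. -/
theorem TendstoLocallyUniformlyOn.analyticOnNhd {E F : Type u} [NormedAddCommGroup E]
    [NormedSpace ℂ E] [LocallyCompactSpace E] [NormedAddCommGroup F] [NormedSpace ℂ F] [CompleteSpace F] {U : Set E}
    {f : ℕ → E → F} {g : E → F} (hU : IsOpen U) (hf : ∀ i, AnalyticOnNhd ℂ (f i) U)
    (h : TendstoLocallyUniformlyOn f g atTop U) : AnalyticOnNhd ℂ g U :=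
  analyticOnNhd_of_forall_contDiffOn hU fun k => h.contDiffOn_complex hU k hf

end AnalyticLimits

/-! ### Quadratic means on spheres and least harmonic majorants -/

section QuadraticMean

open InnerProductSpace Filter Metric MeasureTheory

theorem finrank_real_euclideanSpace_complex (n : ℕ) :
    Module.finrank ℝ (EuclideanSpace ℂ (Fin n)) = 2 * n := by
  rw [← Module.finrank_mul_finrank ℝ ℂ (EuclideanSpace ℂ (Fin n)), Complex.finrank_real_complex,
    finrank_euclideanSpace_fin]

/-- Compactness of closed balls in a form that yields one limit for every bounded family at once.
Limits along a fixed ultrafilter are additive and homogeneous, so limiting functionals and inner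
products come out linear without any extraction of subsequences. -/
theorem Ultrafilter.exists_tendsto_of_norm_le {ι X : Type*} [NormedAddCommGroup X]
    [ProperSpace X] (𝒰 : Ultrafilter ι) {φ : ι → X} {C : ℝ} (h : ∀ᶠ i in 𝒰, ‖φ i‖ ≤ C) :
    ∃ l, Tendsto φ 𝒰 (𝓝 l) := by
  obtain ⟨l, -, hl⟩ := (isCompact_closedBall (0 : X) C).ultrafilter_le_nhds (𝒰.map φ) (by
    rw [le_principal_iff]
    change ∀ᶠ i in 𝒰, φ i ∈ closedBall 0 C
    simpa using h)
  exact ⟨l, hl⟩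

variable {n : ℕ}

local notation "𝔼" => EuclideanSpace ℂ (Fin n)

theorem add_smul_sphere_mem_ball {a : 𝔼} {ρ t : ℝ} (ht : t ∈ Set.Ioo 0 ρ)
    (z : sphere (0 : 𝔼) 1) : a + t • (z : 𝔼) ∈ ball a ρ := by
  rw [mem_ball_iff_norm, add_sub_cancel_left, norm_smul, Real.norm_of_nonneg ht.1.le]
  simpa using ht.2

theorem add_smul_mem_ball {a x : 𝔼} {ρ t : ℝ} (ht : t ∈ Set.Ioo 0 ρ) (hx : ‖x‖ ≤ 1) :
    a + t • x ∈ ball a ρ := by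
  rw [mem_ball_iff_norm, add_sub_cancel_left, norm_smul, Real.norm_of_nonneg ht.1.le]
  exact (mul_le_of_le_one_right ht.1.le hx).trans_lt ht.2

/-- The quadratic mean of `F` over the sphere of radius `t` centred at `a`. -/
noncomputable def quadraticMean (a : 𝔼) (F : 𝔼 → ℂ) (t : ℝ) : ℝ :=
  ∫ z : sphere (0 : 𝔼) 1, ‖F (a + t • (z : 𝔼))‖ ^ 2 ∂(sphereMeasure 𝔼)

theorem ContinuousOn.continuous_dilate_sphere {Y : Type*} [TopologicalSpace Y] {F : 𝔼 → Y} {a : 𝔼}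
    {ρ : ℝ} (hF : ContinuousOn F (ball a ρ)) {t : ℝ} (ht : t ∈ Set.Ioo 0 ρ) :
    Continuous fun z : sphere (0 : 𝔼) 1 => F (a + t • (z : 𝔼)) :=
  hF.comp_continuous (by fun_prop) (add_smul_sphere_mem_ball ht)

theorem quadraticMean_nonneg (a : 𝔼) (F : 𝔼 → ℂ) (t : ℝ) : 0 ≤ quadraticMean a F t :=
  integral_nonneg fun _ => by positivity

variable [NeZero n]

/-- The Poisson formula on the sphere of radius `t` centred at `a`. -/
theorem InnerProductSpace.HarmonicOnNhd.eq_poisson_dilate {w : 𝔼 → ℝ} {a : 𝔼} {ρ : ℝ}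
    (hw : HarmonicOnNhd w (ball a ρ)) {t : ℝ} (ht : t ∈ Set.Ioo 0 ρ)
    {f : C(sphere (0 : 𝔼) 1, ℝ)} (hf : ∀ z : sphere (0 : 𝔼) 1, f z = w (a + t • (z : 𝔼)))
    {x : 𝔼} (hx : ‖x‖ < 1) :
    w (a + t • x) = sphereMean 𝔼 (poissonKernelMap n x * f) := by
  refine HarmonicOnNhd.eq_poisson (w := fun y => w (a + t • y))
    (finrank_real_euclideanSpace_complex n) (fun y hy => ?_) ?_ hf hx
  · exact HarmonicAt.comp_add_smul (hw _ (add_smul_mem_ball ht (by simpa using (mem_ball.1 hy).le)))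
  · refine hw.continuousOn.comp (by fun_prop) fun y hy => add_smul_mem_ball ht (by simpa using hy)

/-- The real and imaginary parts are harmonic, and the squares of each satisfy `sq_le_poisson`; the
two inequalities add up. -/
theorem AnalyticOnNhd.norm_sq_le_poisson_dilate {F : 𝔼 → ℂ} {a : 𝔼} {ρ : ℝ}
    (hF : AnalyticOnNhd ℂ F (ball a ρ)) {t : ℝ} (ht : t ∈ Set.Ioo 0 ρ)
    {f : C(sphere (0 : 𝔼) 1, ℝ)} (hf : ∀ z : sphere (0 : 𝔼) 1, f z = ‖F (a + t • (z : 𝔼))‖ ^ 2)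
    {x : 𝔼} (hx : ‖x‖ < 1) :
    ‖F (a + t • x)‖ ^ 2 ≤ sphereMean 𝔼 (poissonKernelMap n x * f) := by
  have hc : ContinuousOn (fun y : 𝔼 => F (a + t • y)) (closedBall 0 1) :=
    hF.continuousOn.comp (by fun_prop) fun y hy => add_smul_mem_ball ht (by simpa using hy)
  have hcs : Continuous fun z : sphere (0 : 𝔼) 1 => F (a + t • (z : 𝔼)) :=
    hc.comp_continuous continuous_subtype_val fun z => sphere_subset_closedBall z.2
  have hh : ∀ l : ℂ →L[ℝ] ℝ, HarmonicOnNhd (fun y : 𝔼 => l (F (a + t • y))) (ball 0 1) :=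
    fun l y hy => by
      have hF' := (hF _ (add_smul_mem_ball ht (by simpa using (mem_ball.1 hy).le))).harmonicAt_euclidean
      exact HarmonicAt.comp_add_smul (f := l ∘ F) (hF'.comp_CLM l)
  have key : ∀ l : ℂ →L[ℝ] ℝ, (l (F (a + t • x))) ^ 2 ≤ sphereMean 𝔼 (poissonKernelMap n x *
      ⟨fun z : sphere (0 : 𝔼) 1 => (l (F (a + t • (z : 𝔼)))) ^ 2,
        (l.continuous.comp hcs).pow 2⟩) := fun l =>
    (hh l).sq_le_poisson (finrank_real_euclideanSpace_complex n) (l.continuous.comp_continuousOn hc)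
      (fun z => le_rfl) hx
  have h := add_le_add (key Complex.reCLM) (key Complex.imCLM)
  rw [← map_add, ← mul_add] at h
  have hsq : ∀ c : ℂ, ‖c‖ ^ 2 = Complex.reCLM c ^ 2 + Complex.imCLM c ^ 2 := fun c => by
    rw [Complex.sq_norm, Complex.normSq_apply, sq, sq]; rfl
  rw [← hsq] at h
  convert! h using 3
  ext z
  rw [hf, hsq]
  rfl

/-- The Poisson kernel at the center is `1`, so `w a` is the mean of `w` over every sphere about
`a`. -/
theorem quadraticMean_le_of_majorant {F : 𝔼 → ℂ} {w : 𝔼 → ℝ} {a : 𝔼} {ρ : ℝ}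
    (hF : ContinuousOn F (ball a ρ)) (hw : HarmonicOnNhd w (ball a ρ))
    (hle : ∀ z ∈ ball a ρ, ‖F z‖ ^ 2 ≤ w z) {t : ℝ} (ht : t ∈ Set.Ioo 0 ρ) :
    quadraticMean a F t ≤ w a := by
  have h1 := hw.eq_poisson_dilate ht (f := ⟨_, hw.continuousOn.continuous_dilate_sphere ht⟩)
    (fun z => rfl) (x := 0) (by simp)
  rw [smul_zero, add_zero, poissonKernelMap_zero, one_mul] at h1
  rw [h1]
  exact sphereMean_mono (f := ⟨_, (hF.continuous_dilate_sphere ht).norm.pow 2⟩) fun z =>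
    hle _ (add_smul_sphere_mem_ball ht z)

/-- If the quadratic means of the analytic function `F` on the ball are bounded, then `|F|²` has a
least harmonic majorant, whose value at the center is the limit of the quadratic means. -/
theorem AnalyticOnNhd.exists_least_harmonic_majorant {F : 𝔼 → ℂ} {a : 𝔼} {ρ : ℝ} (hρ : 0 < ρ)
    (hF : AnalyticOnNhd ℂ F (ball a ρ)) {C : ℝ}
    (hC : ∀ t ∈ Set.Ioo 0 ρ, quadraticMean a F t ≤ C) {𝒰 : Ultrafilter ℝ} (h𝒰 : 𝒰 ≤ 𝓝[<] ρ) :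
    ∃ u : 𝔼 → ℝ, HarmonicOnNhd u (ball a ρ) ∧ (∀ z ∈ ball a ρ, ‖F z‖ ^ 2 ≤ u z) ∧
      (∀ w : 𝔼 → ℝ, HarmonicOnNhd w (ball a ρ) → (∀ z ∈ ball a ρ, ‖F z‖ ^ 2 ≤ w z) →
        ∀ z ∈ ball a ρ, u z ≤ w z) ∧
      Tendsto (quadraticMean a F) 𝒰 (𝓝 (u a)) ∧
      ∀ z ∈ ball a ρ, u z ≤ ‖poissonKernelMap n (ρ⁻¹ • (z - a))‖ * u a := by
  classical
  have hmem : ∀ᶠ t in (𝒰 : Filter ℝ), t ∈ Set.Ioo 0 ρ := h𝒰 (Ioo_mem_nhdsLT hρ)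
  have hcont : ∀ {t}, t ∈ Set.Ioo 0 ρ →
      Continuous fun z : sphere (0 : 𝔼) 1 => ‖F (a + t • (z : 𝔼))‖ ^ 2 := fun ht =>
    (hF.continuousOn.continuous_dilate_sphere ht).norm.pow 2
  -- The value `0` outside `(0, ρ)` is never seen by `𝒰`, but it keeps `φ t` nonnegative for every
  -- `t`.
  set φ : ℝ → C(sphere (0 : 𝔼) 1, ℝ) := fun t =>
    if ht : t ∈ Set.Ioo 0 ρ then ⟨_, hcont ht⟩ else 0 with hφdef
  have hφ : ∀ {t}, t ∈ Set.Ioo 0 ρ → ∀ z, φ t z = ‖F (a + t • (z : 𝔼))‖ ^ 2 := by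
    intro t ht z
    simp only [hφdef, dif_pos ht]
    rfl
  have hφ0 : ∀ t z, 0 ≤ φ t z := by
    intro t z
    by_cases ht : t ∈ Set.Ioo 0 ρ
    · rw [hφ ht]; positivity
    · simp only [hφdef, dif_neg ht]; exact le_rfl
  have hφM : ∀ {t}, t ∈ Set.Ioo 0 ρ → sphereMean 𝔼 (φ t) = quadraticMean a F t := by
    intro t ht
    simp only [sphereMean_apply, hφ ht, quadraticMean]
  have hupper : ∀ t (g : C(sphere (0 : 𝔼) 1, ℝ)),
      sphereMean 𝔼 (g * φ t) ≤ ‖g‖ * sphereMean 𝔼 (φ t) := by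
    intro t g
    rw [← smul_eq_mul ‖g‖, ← map_smul]
    refine sphereMean_mono fun z => ?_
    have := (le_abs_self _).trans (g.norm_coe_le_norm z)
    exact mul_le_mul_of_nonneg_right this (hφ0 t z)
  have hbd : ∀ (g : C(sphere (0 : 𝔼) 1, ℝ)), ∀ᶠ t in (𝒰 : Filter ℝ),
      ‖sphereMean 𝔼 (g * φ t)‖ ≤ C * ‖g‖ := by
    intro g
    filter_upwards [hmem] with t ht
    have h1 := hupper t g
    have h2 := hupper t (-g)
    rw [neg_mul, map_neg, norm_neg] at h2
    have h3 : ‖g‖ * sphereMean 𝔼 (φ t) ≤ C * ‖g‖ := by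
      rw [hφM ht, mul_comm]
      exact mul_le_mul_of_nonneg_right (hC t ht) (norm_nonneg _)
    rw [Real.norm_eq_abs, abs_le]
    constructor <;> linarith
  -- The limit functional stands in for the boundary measure of `|F|²`; uniqueness of limits makes
  -- it linear, and `C` bounds it.
  choose l hl using fun g => 𝒰.exists_tendsto_of_norm_le (hbd g)
  let L : C(sphere (0 : 𝔼) 1, ℝ) →L[ℝ] ℝ := LinearMap.mkContinuous
    { toFun := l
      map_add' := fun f g => tendsto_nhds_unique (hl (f + g))
        (by simpa only [add_mul, map_add] using (hl f).add (hl g))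
      map_smul' := fun c f => tendsto_nhds_unique (hl (c • f))
        (by simpa only [smul_mul_assoc, map_smul] using! (hl f).const_smul c) } C
    fun g => le_of_tendsto (hl g).norm (hbd g)
  have hL : ∀ g, Tendsto (fun t => sphereMean 𝔼 (g * φ t)) 𝒰 (𝓝 (L g)) := hl
  have hball : ∀ {z}, z ∈ ball a ρ → ‖ρ⁻¹ • (z - a)‖ < 1 := by
    intro z hz
    rw [mem_ball_iff_norm] at hz
    rw [norm_smul, norm_inv, Real.norm_of_nonneg hρ.le, inv_mul_lt_iff₀ hρ, mul_one]
    exact hz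
  have hlim : ∀ z, Tendsto (fun t : ℝ => a + t • (ρ⁻¹ • (z - a))) 𝒰 (𝓝 z) := by
    intro z
    have h1 : Continuous fun t : ℝ => a + t • (ρ⁻¹ • (z - a)) := by fun_prop
    have h2 := (h1.tendsto ρ).mono_left (h𝒰.trans nhdsWithin_le_nhds)
    simpa [smul_smul, hρ.ne'] using h2
  -- The majorant is the Poisson integral of `L`. The five claims are checked at radius `t`, at the
  -- point `a + t • ρ⁻¹ • (z - a)`, which tends to `z` along `𝒰`, or directly from the harmonicity
  -- of the kernel.
  refine ⟨fun z => L (poissonKernelMap n (ρ⁻¹ • (z - a))), fun z hz => ?_, fun z hz => ?_,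
    fun w hw hFw z hz => ?_, ?_, fun z hz => ?_⟩
  · have h1 := harmonicOnNhd_clm_poissonKernelMap (finrank_real_euclideanSpace_complex n) L
    have h2 : ∀ z, ρ⁻¹ • (z - a) = (-(ρ⁻¹ • a)) + ρ⁻¹ • z := fun z => by
      rw [smul_sub]; abel
    simp only [h2]
    refine HarmonicAt.comp_add_smul (f := fun x => L (poissonKernelMap n x)) (h1 _ ?_)
    rw [← h2]
    simpa using hball hz
  · have h1 : Tendsto (fun t : ℝ => ‖F (a + t • (ρ⁻¹ • (z - a)))‖ ^ 2) 𝒰 (𝓝 (‖F z‖ ^ 2)) :=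
      (((hF z hz).continuousAt.tendsto.comp (hlim z)).norm.pow 2)
    refine le_of_tendsto_of_tendsto h1 (hL _) ?_
    filter_upwards [hmem] with t ht using hF.norm_sq_le_poisson_dilate ht (hφ ht) (hball hz)
  · have h1 : Tendsto (fun t : ℝ => w (a + t • (ρ⁻¹ • (z - a)))) 𝒰 (𝓝 (w z)) :=
      (hw z hz).1.continuousAt.tendsto.comp (hlim z)
    refine le_of_tendsto_of_tendsto (hL _) h1 ?_
    filter_upwards [hmem] with t ht
    -- By the Poisson formula for `w` and positivity of the kernel, `|F|² ≤ w` on the sphere passes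
    -- to the Poisson integrals.
    rw [hw.eq_poisson_dilate ht (f := ⟨_, hw.continuousOn.continuous_dilate_sphere ht⟩)
      (fun z => rfl) (hball hz)]
    refine sphereMean_mono fun y => ?_
    refine mul_le_mul_of_nonneg_left ?_ (poissonKernelMap_nonneg n (hball hz) y)
    rw [hφ ht]
    exact hFw _ (add_smul_sphere_mem_ball ht y)
  · have h1 := hL 1
    simp only [one_mul] at h1
    simp only [sub_self, smul_zero, poissonKernelMap_zero]
    refine h1.congr' ?_
    filter_upwards [hmem] with t ht using hφM ht
  · have h1 := hL 1
    simp only [one_mul] at h1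
    simp only [sub_self, smul_zero, poissonKernelMap_zero]
    exact le_of_tendsto_of_tendsto' (hL _) (h1.const_mul _) fun t => hupper t _

end QuadraticMean

/-! ### The Hilbert space `H²` of a ball -/

section ExtendZero

variable {n : ℕ} {Ω : TopologicalSpace.Opens (EuclideanSpace ℂ (Fin n))}

/-- Extension by zero of a function on `Ω`. -/
noncomputable abbrev extendZero (h : Ω → ℂ) : EuclideanSpace ℂ (Fin n) → ℂ :=
  Function.extend Subtype.val h 0

theorem extendZero_apply (h : Ω → ℂ) (z : Ω) : extendZero h z = h z :=
  Subtype.val_injective.extend_apply h 0 z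

theorem extendZero_of_mem (h : Ω → ℂ) {z : EuclideanSpace ℂ (Fin n)} (hz : z ∈ Ω) :
    extendZero h z = h ⟨z, hz⟩ := extendZero_apply h ⟨z, hz⟩

theorem extendZero_of_notMem (h : Ω → ℂ) {z : EuclideanSpace ℂ (Fin n)} (hz : z ∉ Ω) :
    extendZero h z = 0 :=
  Function.extend_apply' _ _ _ fun ⟨w, hw⟩ => hz (hw ▸ w.2)

theorem extendZero_add (f g : Ω → ℂ) : extendZero (f + g) = extendZero f + extendZero g := by
  ext z
  by_cases hz : z ∈ Ω
  · simp only [Pi.add_apply, extendZero_of_mem _ hz]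
  · simp only [Pi.add_apply, extendZero_of_notMem _ hz, add_zero]

theorem extendZero_smul (c : ℂ) (f : Ω → ℂ) : extendZero (c • f) = c • extendZero f := by
  ext z
  by_cases hz : z ∈ Ω
  · simp only [Pi.smul_apply, extendZero_of_mem _ hz]
  · simp only [Pi.smul_apply, extendZero_of_notMem _ hz, smul_zero]

theorem extendZero_mul (f g : Ω → ℂ) : extendZero (f * g) = extendZero f * extendZero g := by
  ext z
  by_cases hz : z ∈ Ω
  · simp only [Pi.mul_apply, extendZero_of_mem _ hz]
  · simp only [Pi.mul_apply, extendZero_of_notMem _ hz, mul_zero]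

theorem extendZero_sub (f g : Ω → ℂ) : extendZero (f - g) = extendZero f - extendZero g := by
  rw [sub_eq_add_neg, ← neg_one_smul ℂ g, extendZero_add, extendZero_smul, neg_one_smul,
    ← sub_eq_add_neg]

end ExtendZero

/-- A criterion for completeness in terms of the quadratic form of an inner product. -/
theorem completeSpace_of_core {V : Type*} [AddCommGroup V] [Module ℂ V]
    (c : InnerProductSpace.Core ℂ V)
    (h : ∀ s : ℕ → V, (∀ ε > 0, ∃ N, ∀ i ≥ N, ∀ j ≥ N,
        (c.inner (s i - s j) (s i - s j)).re ≤ ε) →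
      ∃ l, ∀ ε > 0, ∃ N, ∀ i ≥ N, (c.inner (s i - l) (s i - l)).re ≤ ε) :
    @CompleteSpace V c.toNormedAddCommGroup.toMetricSpace.toPseudoMetricSpace.toUniformSpace := by
  let _ := c.toNormedAddCommGroup
  let _ : InnerProductSpace ℂ V := InnerProductSpace.ofCore c.toCore
  have hn : ∀ x : V, (c.inner x x).re = ‖x‖ ^ 2 := fun x => inner_self_eq_norm_sq (𝕜 := ℂ) x
  simp only [hn] at h
  refine Metric.complete_of_cauchySeq_tendsto fun s hs => ?_
  rw [Metric.cauchySeq_iff] at hs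
  obtain ⟨l, hl⟩ := h s fun ε hε => by
    obtain ⟨N, hN⟩ := hs (√ε) (Real.sqrt_pos.2 hε)
    refine ⟨N, fun i hi j hj => ?_⟩
    have := (hN i hi j hj).le
    rw [dist_eq_norm] at this
    calc ‖s i - s j‖ ^ 2 ≤ √ε ^ 2 := by gcongr
      _ = ε := Real.sq_sqrt hε.le
  refine ⟨l, Metric.tendsto_atTop.2 fun ε hε => ?_⟩
  obtain ⟨N, hN⟩ := hl ((ε / 2) ^ 2) (by positivity)
  refine ⟨N, fun i hi => ?_⟩
  have := abs_le_of_sq_le_sq' (hN i hi) (by positivity)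
  rw [dist_eq_norm]
  linarith [this.2]

/-! ### The inner product as a limit of sphere means. -/

section HardyHilbert

open InnerProductSpace Filter Metric MeasureTheory

variable {n : ℕ} {a : EuclideanSpace ℂ (Fin n)} {ρ : ℝ}

/-- The mean of `conj F * G` over the sphere of radius `t` centred at `a`. -/
noncomputable def innerMean (a : EuclideanSpace ℂ (Fin n)) (F G : EuclideanSpace ℂ (Fin n) → ℂ)
    (t : ℝ) : ℂ :=
  ∫ z : sphere (0 : EuclideanSpace ℂ (Fin n)) 1,
    (starRingEnd ℂ) (F (a + t • (z : EuclideanSpace ℂ (Fin n)))) *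
      G (a + t • (z : EuclideanSpace ℂ (Fin n))) ∂(sphereMeasure _)

theorem innerMean_self (F : EuclideanSpace ℂ (Fin n) → ℂ) (t : ℝ) :
    innerMean a F F t = (quadraticMean a F t : ℂ) := by
  rw [innerMean, quadraticMean, ← integral_complex_ofReal]
  congr 1
  ext z
  rw [mul_comm, Complex.mul_conj, Complex.normSq_eq_norm_sq]

theorem innerMean_conj_symm (F G : EuclideanSpace ℂ (Fin n) → ℂ) (t : ℝ) :
    (starRingEnd ℂ) (innerMean a G F t) = innerMean a F G t := by
  rw [innerMean, innerMean, ← integral_conj]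
  congr 1
  ext z
  simp [mul_comm]

theorem innerMean_smul_left (c : ℂ) (F G : EuclideanSpace ℂ (Fin n) → ℂ) (t : ℝ) :
    innerMean a (c • F) G t = (starRingEnd ℂ) c * innerMean a F G t := by
  rw [innerMean, innerMean, ← integral_const_mul]
  congr 1
  ext z
  simp [mul_assoc]

/-- A fixed ultrafilter of radii converging to `ρ` from below. -/
noncomputable def radiiUltrafilter (ρ : ℝ) : Ultrafilter ℝ := Ultrafilter.of (𝓝[<] ρ)

theorem radiiUltrafilter_le (ρ : ℝ) : (radiiUltrafilter ρ : Filter ℝ) ≤ 𝓝[<] ρ :=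
  Ultrafilter.of_le _

theorem eventually_mem_Ioo_radiiUltrafilter (hρ : 0 < ρ) :
    ∀ᶠ t in (radiiUltrafilter ρ : Filter ℝ), t ∈ Set.Ioo 0 ρ :=
  radiiUltrafilter_le ρ (Ioo_mem_nhdsLT hρ)

/-- The inner product of `H²` of the ball. -/
noncomputable def hardyInner (a : EuclideanSpace ℂ (Fin n)) (ρ : ℝ)
    (F G : EuclideanSpace ℂ (Fin n) → ℂ) : ℂ :=
  limUnder (radiiUltrafilter ρ : Filter ℝ) (innerMean a F G)

variable [NeZero n]

theorem integrable_sphere_of_continuous {X : Type*} [NormedAddCommGroup X]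
    {φ : sphere (0 : EuclideanSpace ℂ (Fin n)) 1 → X} (h : Continuous φ) :
    Integrable φ (sphereMeasure (EuclideanSpace ℂ (Fin n))) :=
  h.integrable_of_hasCompactSupport (HasCompactSupport.of_compactSpace _)

theorem innerMean_add_left {F G K : EuclideanSpace ℂ (Fin n) → ℂ}
    (hF : ContinuousOn F (ball a ρ)) (hG : ContinuousOn G (ball a ρ))
    (hK : ContinuousOn K (ball a ρ)) {t : ℝ} (ht : t ∈ Set.Ioo 0 ρ) :
    innerMean a (F + G) K t = innerMean a F K t + innerMean a G K t := by
  have hF := hF.continuous_dilate_sphere ht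
  have hG := hG.continuous_dilate_sphere ht
  have hK := hK.continuous_dilate_sphere ht
  refine Eq.trans ?_ (integral_add
    (integrable_sphere_of_continuous ((Complex.continuous_conj.comp hF).mul hK))
    (integrable_sphere_of_continuous ((Complex.continuous_conj.comp hG).mul hK)))
  rw [innerMean]
  congr 1
  ext z
  simp [add_mul]

theorem norm_innerMean_le {F G : EuclideanSpace ℂ (Fin n) → ℂ}
    (hF : ContinuousOn F (ball a ρ)) (hG : ContinuousOn G (ball a ρ)) {t : ℝ}
    (ht : t ∈ Set.Ioo 0 ρ) :
    ‖innerMean a F G t‖ ≤ quadraticMean a F t + quadraticMean a G t := by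
  have hF := hF.continuous_dilate_sphere ht
  have hG := hG.continuous_dilate_sphere ht
  have iF := integrable_sphere_of_continuous (hF.norm.pow 2)
  have iG := integrable_sphere_of_continuous (hG.norm.pow 2)
  rw [show quadraticMean a F t + quadraticMean a G t = _ from (integral_add iF iG).symm]
  refine (norm_integral_le_integral_norm _).trans (integral_mono ?_ (iF.add iG) fun z => ?_)
  · exact (integrable_sphere_of_continuous ((Complex.continuous_conj.comp hF).mul hG)).norm
  · change ‖_ * _‖ ≤ ‖F (a + t • (z : EuclideanSpace ℂ (Fin n)))‖ ^ 2 +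
      ‖G (a + t • (z : EuclideanSpace ℂ (Fin n)))‖ ^ 2
    rw [norm_mul, RCLike.norm_conj]
    nlinarith [sq_nonneg (‖F (a + t • (z : EuclideanSpace ℂ (Fin n)))‖ -
      ‖G (a + t • (z : EuclideanSpace ℂ (Fin n)))‖),
      sq_nonneg ‖F (a + t • (z : EuclideanSpace ℂ (Fin n)))‖,
      sq_nonneg ‖G (a + t • (z : EuclideanSpace ℂ (Fin n)))‖]

omit [NeZero n] in
theorem IsAnalyticFun.analyticOnNhd_extendZero {h : openBall a ρ → ℂ} (hh : IsAnalyticFun h) :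
    AnalyticOnNhd ℂ (extendZero h) (ball a ρ) := hh

/-- Membership in `H²` in terms of quadratic means over spheres. -/
theorem mem_hardySpace_openBall_iff (hρ : 0 < ρ) {h : openBall a ρ → ℂ} :
    h ∈ hardySpace (openBall a ρ) ↔ IsAnalyticFun h ∧
      ∃ C, ∀ t ∈ Set.Ioo 0 ρ, quadraticMean a (extendZero h) t ≤ C := by
  constructor
  · rintro ⟨hh, u, hu, hle⟩
    refine ⟨hh, u a, fun t ht => quadraticMean_le_of_majorant
      hh.analyticOnNhd_extendZero.continuousOn hu (fun z hz => ?_) ht⟩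
    rw [extendZero_of_mem (Ω := openBall a ρ) h hz]
    exact hle ⟨z, hz⟩
  · rintro ⟨hh, C, hC⟩
    obtain ⟨u, hu, hle, -⟩ := hh.analyticOnNhd_extendZero.exists_least_harmonic_majorant hρ hC
      (radiiUltrafilter_le ρ)
    refine ⟨hh, u, hu, fun z => ?_⟩
    rw [← extendZero_apply h z]
    exact hle z z.2

/-- Every `|h|²` with `h ∈ H²` has a least harmonic majorant, controlled by its value at the
center. -/
theorem exists_isLeastHarmonicMajorant (hρ : 0 < ρ) {h : openBall a ρ → ℂ}
    (hh : h ∈ hardySpace (openBall a ρ)) :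
    ∃ u, IsLeastHarmonicMajorant h u ∧
      Tendsto (quadraticMean a (extendZero h)) (radiiUltrafilter ρ : Filter ℝ) (𝓝 (u a)) ∧
      (∀ t ∈ Set.Ioo 0 ρ, quadraticMean a (extendZero h) t ≤ u a) ∧
      ∀ z : openBall a ρ, ‖h z‖ ^ 2 ≤
        ‖poissonKernelMap n (ρ⁻¹ • ((z : EuclideanSpace ℂ (Fin n)) - a))‖ * u a := by
  obtain ⟨ha, C, hC⟩ := (mem_hardySpace_openBall_iff hρ).1 hh
  obtain ⟨u, hu, hle, hmin, hlim, hK⟩ :=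
    ha.analyticOnNhd_extendZero.exists_least_harmonic_majorant hρ hC (radiiUltrafilter_le ρ)
  have hle' : ∀ z : openBall a ρ, ‖h z‖ ^ 2 ≤ u z := fun z => by
    rw [← extendZero_apply h z]; exact hle z z.2
  refine ⟨u, ⟨⟨hu, hle'⟩, fun w hw z => hmin w hw.1 (fun y hy => ?_) z z.2⟩, hlim,
    fun t ht => quadraticMean_le_of_majorant ha.analyticOnNhd_extendZero.continuousOn hu hle ht,
    fun z => (hle' z).trans (hK z z.2)⟩
  rw [extendZero_of_mem (Ω := openBall a ρ) h hy]
  exact hw.2 ⟨y, hy⟩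

/-- The means are bounded by the sum of the bounds on the quadratic means, so the ultrafilter limit
exists and `limUnder` is a genuine limit. The inner product axioms reduce to this. -/
theorem tendsto_innerMean (hρ : 0 < ρ) {f g : openBall a ρ → ℂ}
    (hf : f ∈ hardySpace (openBall a ρ)) (hg : g ∈ hardySpace (openBall a ρ)) :
    Tendsto (innerMean a (extendZero f) (extendZero g)) (radiiUltrafilter ρ : Filter ℝ)
      (𝓝 (hardyInner a ρ (extendZero f) (extendZero g))) := by
  obtain ⟨haf, C, hC⟩ := (mem_hardySpace_openBall_iff hρ).1 hf
  obtain ⟨hag, D, hD⟩ := (mem_hardySpace_openBall_iff hρ).1 hg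
  refine tendsto_nhds_limUnder ((radiiUltrafilter ρ).exists_tendsto_of_norm_le (C := C + D) ?_)
  filter_upwards [eventually_mem_Ioo_radiiUltrafilter hρ] with t ht
  exact (norm_innerMean_le haf.analyticOnNhd_extendZero.continuousOn
    hag.analyticOnNhd_extendZero.continuousOn ht).trans (add_le_add (hC t ht) (hD t ht))

theorem hardyInner_self_eq (hρ : 0 < ρ) {h : openBall a ρ → ℂ}
    (hh : h ∈ hardySpace (openBall a ρ)) {c : ℝ}
    (hc : Tendsto (quadraticMean a (extendZero h)) (radiiUltrafilter ρ : Filter ℝ) (𝓝 c)) :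
    hardyInner a ρ (extendZero h) (extendZero h) = c := by
  refine tendsto_nhds_unique (tendsto_innerMean hρ hh hh) ?_
  rw [show innerMean a (extendZero h) (extendZero h) = _ from funext (innerMean_self _)]
  exact (Complex.continuous_ofReal.tendsto c).comp hc

/-- The inner product space structure of `H²` of the ball. -/
@[reducible] noncomputable def hardyCore (a : EuclideanSpace ℂ (Fin n)) (hρ : 0 < ρ) :
    InnerProductSpace.Core ℂ (hardySpace (openBall a ρ)) where
  inner f g := hardyInner a ρ (extendZero (f : openBall a ρ → ℂ)) (extendZero (g : openBall a ρ → ℂ))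
  conj_inner_symm f g := by
    refine tendsto_nhds_unique ((Complex.continuous_conj.tendsto _).comp
      (tendsto_innerMean hρ g.2 f.2)) ?_
    refine (tendsto_innerMean hρ f.2 g.2).congr fun t => ?_
    exact (innerMean_conj_symm _ _ _).symm
  re_inner_nonneg f := by
    obtain ⟨u, -, hu, -⟩ := exists_isLeastHarmonicMajorant hρ f.2
    rw [hardyInner_self_eq hρ f.2 hu]
    exact ge_of_tendsto' hu fun t => quadraticMean_nonneg _ _ _
  add_left f g k := by
    refine tendsto_nhds_unique (tendsto_innerMean hρ (f + g).2 k.2) ?_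
    refine ((tendsto_innerMean hρ f.2 k.2).add (tendsto_innerMean hρ g.2 k.2)).congr' ?_
    filter_upwards [eventually_mem_Ioo_radiiUltrafilter hρ] with t ht
    rw [Submodule.coe_add, extendZero_add]
    exact (innerMean_add_left f.2.1.analyticOnNhd_extendZero.continuousOn
      g.2.1.analyticOnNhd_extendZero.continuousOn
      k.2.1.analyticOnNhd_extendZero.continuousOn ht).symm
  smul_left f g c := by
    refine tendsto_nhds_unique (tendsto_innerMean hρ (c • f).2 g.2) ?_
    refine ((tendsto_innerMean hρ f.2 g.2).const_mul _).congr fun t => ?_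
    rw [Submodule.coe_smul, extendZero_smul, innerMean_smul_left]
  -- Norm zero means `u a = 0`, and the bound on point evaluations by `u a` kills every value of
  -- `f`.
  definite f hf := by
    obtain ⟨u, -, hu, -, hle⟩ := exists_isLeastHarmonicMajorant hρ f.2
    have h0 : u a = 0 := by
      have := (hardyInner_self_eq hρ f.2 hu).symm.trans hf
      exact_mod_cast this
    ext z
    have := hle z
    rw [h0, mul_zero] at this
    have h1 : ‖(f : openBall a ρ → ℂ) z‖ ^ 2 = 0 := le_antisymm this (by positivity)
    simpa using h1

end HardyHilbert

/-! ### Point evaluations and completeness. -/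

section HardyComplete

open InnerProductSpace Filter Metric MeasureTheory

variable {n : ℕ} {a : EuclideanSpace ℂ (Fin n)} {ρ : ℝ}

/-- The constant in the bound for point evaluations at `z` on `H²` of the ball. -/
noncomputable def evaluationBound (a : EuclideanSpace ℂ (Fin n)) (ρ : ℝ)
    (z : EuclideanSpace ℂ (Fin n)) : ℝ :=
  ‖poissonKernelMap n (ρ⁻¹ • (z - a))‖

theorem evaluationBound_nonneg (z : EuclideanSpace ℂ (Fin n)) : 0 ≤ evaluationBound a ρ z :=
  norm_nonneg _

theorem continuousOn_evaluationBound (hρ : 0 < ρ) :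
    ContinuousOn (evaluationBound a ρ) (ball a ρ) := by
  refine ((continuousOn_poissonKernelMap n).comp
    (f := fun z => ρ⁻¹ • (z - a)) (by fun_prop) fun z hz => ?_).norm
  rw [mem_ball_iff_norm] at hz
  rw [mem_ball_zero_iff, norm_smul, norm_inv, Real.norm_of_nonneg hρ.le, inv_mul_lt_iff₀ hρ,
    mul_one]
  exact hz

variable [NeZero n]

/-- Two least majorants agree at the center, so the ultrafilter limit is `u a` for any of them. In
particular the norm does not depend on the ultrafilter. -/
theorem hardyCore_inner_self_re (hρ : 0 < ρ) (h : hardySpace (openBall a ρ))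
    {u : EuclideanSpace ℂ (Fin n) → ℝ} (hu : IsLeastHarmonicMajorant (h : openBall a ρ → ℂ) u) :
    ((hardyCore a hρ).inner h h).re = u a := by
  obtain ⟨v, hv, hlim, -⟩ := exists_isLeastHarmonicMajorant hρ h.2
  have hva : v a = u a := le_antisymm (hv.2 u hu.1 ⟨a, mem_ball_self hρ⟩)
    (hu.2 v hv.1 ⟨a, mem_ball_self hρ⟩)
  change (hardyInner a ρ _ _).re = _
  rw [hardyInner_self_eq hρ h.2 hlim, Complex.ofReal_re, hva]

theorem quadraticMean_le_inner_self (hρ : 0 < ρ) (h : hardySpace (openBall a ρ)) {t : ℝ}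
    (ht : t ∈ Set.Ioo 0 ρ) :
    quadraticMean a (extendZero (h : openBall a ρ → ℂ)) t ≤ ((hardyCore a hρ).inner h h).re := by
  obtain ⟨u, hu, -, hle, -⟩ := exists_isLeastHarmonicMajorant hρ h.2
  rw [hardyCore_inner_self_re hρ h hu]
  exact hle t ht

theorem inner_self_le_of_quadraticMean_le (hρ : 0 < ρ) (h : hardySpace (openBall a ρ)) {C : ℝ}
    (hC : ∀ t ∈ Set.Ioo 0 ρ, quadraticMean a (extendZero (h : openBall a ρ → ℂ)) t ≤ C) :
    ((hardyCore a hρ).inner h h).re ≤ C := by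
  obtain ⟨u, hu, hlim, -⟩ := exists_isLeastHarmonicMajorant hρ h.2
  rw [hardyCore_inner_self_re hρ h hu]
  refine le_of_tendsto hlim ?_
  filter_upwards [eventually_mem_Ioo_radiiUltrafilter hρ] with t ht using hC t ht

theorem norm_sq_le_evaluationBound_mul (hρ : 0 < ρ) (h : hardySpace (openBall a ρ))
    (z : openBall a ρ) : ‖(h : openBall a ρ → ℂ) z‖ ^ 2 ≤
      evaluationBound a ρ z * ((hardyCore a hρ).inner h h).re := by
  obtain ⟨u, hu, -, -, hle⟩ := exists_isLeastHarmonicMajorant hρ h.2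
  rw [hardyCore_inner_self_re hρ h hu]
  exact hle z

/-- The evaluation bound turns a norm Cauchy sequence into a locally uniformly Cauchy one, whose
limit is analytic. Bounds on quadratic means over each fixed sphere survive the passage to the
limit, uniformly in the radius, which gives both membership and norm convergence. -/
theorem hardyCore_complete (a : EuclideanSpace ℂ (Fin n)) (hρ : 0 < ρ) :
    @CompleteSpace (hardySpace (openBall a ρ))
      (hardyCore a hρ).toNormedAddCommGroup.toMetricSpace.toPseudoMetricSpace.toUniformSpace := by
  refine completeSpace_of_core _ fun s hs => ?_
  set f : ℕ → openBall a ρ → ℂ := fun i => (s i : openBall a ρ → ℂ)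
  set F : ℕ → EuclideanSpace ℂ (Fin n) → ℂ := fun i => extendZero (f i)
  have hb : ∀ i j, ∀ z ∈ ball a ρ, ‖F i z - F j z‖ ^ 2 ≤
      evaluationBound a ρ z * ((hardyCore a hρ).inner (s i - s j) (s i - s j)).re := by
    intro i j z hz
    have := norm_sq_le_evaluationBound_mul hρ (s i - s j) ⟨z, hz⟩
    simp only [F, extendZero_of_mem (Ω := openBall a ρ) _ hz]
    exact this
  have hanalytic : ∀ i, AnalyticOnNhd ℂ (F i) (ball a ρ) := fun i => (s i).2.1
  have hcauchy : ∀ K ⊆ ball a ρ, IsCompact K → UniformCauchySeqOn F atTop K := by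
    intro K hK hKc
    obtain ⟨M, hM⟩ := hKc.bddAbove_image ((continuousOn_evaluationBound hρ).mono hK)
    have hM' : ∀ z ∈ K, evaluationBound a ρ z ≤ |M| + 1 := fun z hz => by
      have := hM (Set.mem_image_of_mem _ hz)
      have := le_abs_self M
      linarith
    rw [Metric.uniformCauchySeqOn_iff]
    intro ε hε
    have hM0 : 0 < |M| + 1 := by positivity
    obtain ⟨N, hN⟩ := hs ((ε / 2) ^ 2 / (|M| + 1)) (by positivity)
    refine ⟨N, fun i hi j hj z hz => ?_⟩
    have h1 : ‖F i z - F j z‖ ^ 2 ≤ (ε / 2) ^ 2 := by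
      calc ‖F i z - F j z‖ ^ 2 ≤ _ := hb i j z (hK hz)
        _ ≤ (|M| + 1) * ((ε / 2) ^ 2 / (|M| + 1)) :=
          mul_le_mul (hM' z hz) (hN i hi j hj) ((hardyCore a hρ).re_inner_nonneg _) hM0.le
        _ = _ := by field_simp
    have := (abs_le_of_sq_le_sq' h1 (by positivity)).2
    rw [dist_eq_norm]
    linarith
  have hlim : ∀ z : openBall a ρ, ∃ l, Tendsto (fun i => f i z) atTop (𝓝 l) := by
    intro z
    have hc := (hcauchy {(z : EuclideanSpace ℂ (Fin n))} (Set.singleton_subset_iff.2 z.2)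
      isCompact_singleton).cauchySeq (Set.mem_singleton _)
    simp only [F, extendZero_apply] at hc
    exact cauchySeq_tendsto_of_complete hc
  choose g hg using hlim
  set G := extendZero g
  have hFG : ∀ z ∈ ball a ρ, Tendsto (fun i => F i z) atTop (𝓝 (G z)) := by
    intro z hz
    simp only [F, G, extendZero_of_mem (Ω := openBall a ρ) _ hz]
    exact hg ⟨z, hz⟩
  have hloc : TendstoLocallyUniformlyOn F G atTop (ball a ρ) := by
    rw [tendstoLocallyUniformlyOn_iff_forall_isCompact isOpen_ball]
    exact fun K hK hKc => (hcauchy K hK hKc).tendstoUniformlyOn_of_tendsto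
      fun z hz => hFG z (hK hz)
  have hG : AnalyticOnNhd ℂ G (ball a ρ) := hloc.analyticOnNhd isOpen_ball hanalytic
  have hmean : ∀ ε > 0, ∃ N, ∀ i ≥ N, ∀ t ∈ Set.Ioo 0 ρ,
      quadraticMean a (extendZero (f i - g)) t ≤ ε := by
    intro ε hε
    obtain ⟨N, hN⟩ := hs ε hε
    refine ⟨N, fun i hi t ht => ?_⟩
    -- For fixed `t < ρ` the sphere is compact in the ball, so the evaluation bound supplies an
    -- integrable majorant; the resulting `ε` does not depend on `t`.
    have h1 : Tendsto (fun j => quadraticMean a (extendZero (f i - f j)) t) atTop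
        (𝓝 (quadraticMean a (extendZero (f i - g)) t)) := by
      have hcs := fun j => (hanalytic j).continuousOn.continuous_dilate_sphere ht
      have hmem := fun z => add_smul_sphere_mem_ball (a := a) ht z
      refine tendsto_integral_filter_of_dominated_convergence (fun z =>
        evaluationBound a ρ (a + t • (z : EuclideanSpace ℂ (Fin n))) * ε) ?_ ?_ ?_ ?_
      · refine Eventually.of_forall fun j => Continuous.aestronglyMeasurable ?_
        rw [extendZero_sub]
        exact ((hcs i).sub (hcs j)).norm.pow 2
      · filter_upwards [eventually_ge_atTop N] with j hj
        refine Eventually.of_forall fun z => ?_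
        rw [Real.norm_of_nonneg (by positivity), extendZero_sub]
        exact (hb i j _ (hmem z)).trans
          (mul_le_mul_of_nonneg_left (hN i hi j hj) (evaluationBound_nonneg _))
      · exact integrable_sphere_of_continuous
          (((continuousOn_evaluationBound hρ).continuous_dilate_sphere ht).mul continuous_const)
      · refine Eventually.of_forall fun z => ?_
        simp only [extendZero_sub, Pi.sub_apply]
        exact ((tendsto_const_nhds.sub (hFG _ (hmem z))).norm.pow 2)
    refine le_of_tendsto h1 ?_
    filter_upwards [eventually_ge_atTop N] with j hj
    exact (quadraticMean_le_inner_self hρ (s i - s j) ht).trans (hN i hi j hj)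
  have hsub : ∀ i, IsAnalyticFun (f i - g) := fun i => by
    change AnalyticOnNhd ℂ (extendZero (f i - g)) (ball a ρ)
    rw [extendZero_sub]
    exact (hanalytic i).sub hG
  obtain ⟨N, hN⟩ := hmean 1 one_pos
  -- Only the differences are known to have bounded means; `g` is recovered as `f N - (f N - g)`.
  have hd : f N - g ∈ hardySpace (openBall a ρ) :=
    (mem_hardySpace_openBall_iff hρ).2 ⟨hsub N, 1, hN N le_rfl⟩
  have hgmem : g ∈ hardySpace (openBall a ρ) := by
    have := Submodule.sub_mem _ (s N).2 hd
    rwa [show (s N : openBall a ρ → ℂ) - (f N - g) = g from sub_sub_cancel _ _] at this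
  refine ⟨⟨g, hgmem⟩, fun ε hε => ?_⟩
  obtain ⟨N, hN⟩ := hmean ε hε
  exact ⟨N, fun i hi => inner_self_le_of_quadraticMean_le hρ _ (hN i hi)⟩

/-- `H²` of the ball as a Hilbert space of functions. -/
noncomputable def hardyHilbertSpace (a : EuclideanSpace ℂ (Fin n)) (hρ : 0 < ρ) :
    FunctionHilbertSpace (openBall a ρ) where
  carrier := hardySpace (openBall a ρ)
  core := hardyCore a hρ
  complete := hardyCore_complete a hρ

theorem hardyHilbertSpace_norm_sq (hρ : 0 < ρ) (h : (hardyHilbertSpace a hρ).Elem) :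
    ‖h‖ ^ 2 = ((hardyCore a hρ).inner h h).re :=
  (inner_self_eq_norm_sq (𝕜 := ℂ) h).symm

end HardyComplete

/-! ### The order of a zero -/

section ZeroOrder

open Filter Asymptotics

variable {n : ℕ} {Ω : TopologicalSpace.Opens (EuclideanSpace ℂ (Fin n))} {a : Ω}

theorem IsAnalyticFun.analyticAt {f : Ω → ℂ} (hf : IsAnalyticFun f) (a : Ω) :
    AnalyticAt ℂ (extendZero f) (a : EuclideanSpace ℂ (Fin n)) := hf a a.2

/-- On the diagonal the `j`-th derivative is `j!` times the `j`-th term of any expansion, so the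
choice of power series in `zeroOrder` is immaterial. -/
theorem natCast_le_zeroOrder_iff {f : Ω → ℂ} (hf : IsAnalyticFun f) (k : ℕ) :
    (k : ℕ∞) ≤ zeroOrder a f ↔ ∀ j < k, ∀ w,
      iteratedFDeriv ℂ j (extendZero f) (a : EuclideanSpace ℂ (Fin n)) (fun _ => w) = 0 := by
  simp only [zeroOrder, le_iInf_iff, Set.mem_ofPred_eq, Nat.cast_le]
  constructor
  · intro h j hj w
    obtain ⟨p, r, hp⟩ := hf.analyticAt a
    by_contra hne
    refine absurd (h j ⟨p, ⟨r, hp⟩, w, fun h0 => hne ?_⟩) (not_le.2 hj)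
    rw [← hp.factorial_smul, h0, smul_zero]
  · rintro h j ⟨p, ⟨r, hp⟩, w, hw⟩
    by_contra! hj
    have := h j hj w
    rw [← hp.factorial_smul] at this
    exact (smul_ne_zero (Nat.factorial_ne_zero j) hw) this

/-- Growth at the center detects the first nonzero homogeneous term, by induction on its degree. In
this form the rules for sums, products and scalars are those of `O`. -/
theorem natCast_le_zeroOrder_iff_isBigO {f : Ω → ℂ} (hf : IsAnalyticFun f) (k : ℕ) :
    (k : ℕ∞) ≤ zeroOrder a f ↔
      (fun y => extendZero f (a + y)) =O[𝓝 0] fun y : EuclideanSpace ℂ (Fin n) => ‖y‖ ^ k := by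
  rw [natCast_le_zeroOrder_iff hf]
  obtain ⟨p, r, hp⟩ := hf.analyticAt a
  have hp' : HasFPowerSeriesAt (extendZero f) p (a : EuclideanSpace ℂ (Fin n)) := ⟨r, hp⟩
  have hiff : ∀ j w, iteratedFDeriv ℂ j (extendZero f) (a : EuclideanSpace ℂ (Fin n))
      (fun _ => w) = 0 ↔ p j (fun _ => w) = 0 := fun j w => by
    rw [← hp.factorial_smul]
    simp [Nat.factorial_ne_zero]
  simp only [hiff]
  constructor
  · intro h
    have := hp'.isBigO_sub_partialSum_pow k
    have h0 : p.partialSum k = 0 := by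
      ext y
      exact Finset.sum_eq_zero fun j hj => h j (Finset.mem_range.1 hj) y
    simpa [h0] using this
  · intro h j
    induction j using Nat.strong_induction_on with
    | _ j ih =>
      intro hj
      refine IsBigO.continuousMultilinearMap_apply_eq_zero ?_
      have hsum : p.partialSum (j + 1) = fun y => p j fun _ => y := by
        ext y
        rw [FormalMultilinearSeries.partialSum, Finset.sum_range_succ, Finset.sum_eq_zero, zero_add]
        exact fun i hi => ih i (Finset.mem_range.1 hi) ((Finset.mem_range.1 hi).trans hj) y
      have h1 := hp'.isBigO_sub_partialSum_pow (j + 1)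
      rw [hsum] at h1
      have h2 : (fun y : EuclideanSpace ℂ (Fin n) => ‖y‖ ^ k) =O[𝓝 0] fun y => ‖y‖ ^ (j + 1) := by
        refine IsBigO.of_bound 1 ?_
        have hev : ∀ᶠ y : EuclideanSpace ℂ (Fin n) in 𝓝 0, ‖y‖ < 1 :=
          (continuous_norm.tendsto 0).eventually_lt_const (by simp)
        filter_upwards [hev] with y hy
        simp only [norm_pow, norm_norm, one_mul]
        exact pow_le_pow_of_le_one (norm_nonneg _) hy.le hj
      simpa using (h.trans h2).sub h1

theorem one_le_zeroOrder_iff {f : Ω → ℂ} (hf : IsAnalyticFun f) :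
    1 ≤ zeroOrder a f ↔ f a = 0 := by
  have := natCast_le_zeroOrder_iff (a := a) hf 1
  rw [Nat.cast_one] at this
  rw [this]
  simp

theorem zeroOrder_zero : zeroOrder a (0 : Ω → ℂ) = ⊤ := by
  have h0 : extendZero (0 : Ω → ℂ) = 0 := Function.extend_zero _
  refine ENat.eq_top_iff_forall_ge.2 fun k => ?_
  rw [natCast_le_zeroOrder_iff_isBigO (f := 0) (IsAnalyticFun.const 0), h0]
  exact isBigO_zero _ _

/-- Infinite order makes the expansion zero near `a`, and the identity theorem spreads this over a
connected `Ω`. -/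
theorem zeroOrder_eq_top_iff {f : Ω → ℂ} (hf : IsAnalyticFun f)
    (hΩ : IsPreconnected (Ω : Set (EuclideanSpace ℂ (Fin n)))) :
    zeroOrder a f = ⊤ ↔ f = 0 := by
  refine ⟨fun h => ?_, fun h => h ▸ zeroOrder_zero⟩
  obtain ⟨p, r, hp⟩ := hf.analyticAt a
  have h0 : ∀ j w, p j (fun _ => w) = 0 := fun j w => by
    have := (natCast_le_zeroOrder_iff hf (j + 1)).1 (h ▸ le_top) j j.lt_succ_self w
    rw [← hp.factorial_smul] at this
    simpa [Nat.factorial_ne_zero] using this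
  have hev : extendZero f =ᶠ[𝓝 (a : EuclideanSpace ℂ (Fin n))] 0 := by
    filter_upwards [Metric.eball_mem_nhds _ hp.r_pos] with y hy
    have := hp.hasSum_sub hy
    simp only [h0] at this
    exact this.unique hasSum_zero
  have := AnalyticOnNhd.eqOn_zero_of_preconnected_of_eventuallyEq_zero hf hΩ a.2 hev
  ext z
  rw [← extendZero_apply f z]
  exact this z.2

theorem le_zeroOrder_add {f g : Ω → ℂ} (hf : IsAnalyticFun f) (hg : IsAnalyticFun g) :
    min (zeroOrder a f) (zeroOrder a g) ≤ zeroOrder a (f + g) := by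
  refine ENat.forall_natCast_le_iff_le.1 fun k hk => ?_
  rw [le_min_iff, natCast_le_zeroOrder_iff_isBigO hf, natCast_le_zeroOrder_iff_isBigO hg] at hk
  rw [natCast_le_zeroOrder_iff_isBigO (hf.add hg), extendZero_add]
  exact hk.1.add hk.2

theorem ENat.add_le_of_forall_natCast {x y z : ℕ∞}
    (h : ∀ k l : ℕ, (k : ℕ∞) ≤ x → (l : ℕ∞) ≤ y → ((k + l : ℕ) : ℕ∞) ≤ z) : x + y ≤ z := by
  cases x with
  | top =>
    have : z = ⊤ := ENat.eq_top_iff_forall_ge.2 fun k => by simpa using h k 0 le_top (by simp)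
    simp [this]
  | coe x =>
    cases y with
    | top =>
      have : z = ⊤ := ENat.eq_top_iff_forall_ge.2 fun k => by simpa using h 0 k (by simp) le_top
      simp [this]
    | coe y => exact_mod_cast h x y le_rfl le_rfl

theorem le_zeroOrder_mul {f g : Ω → ℂ} (hf : IsAnalyticFun f) (hg : IsAnalyticFun g) :
    zeroOrder a f + zeroOrder a g ≤ zeroOrder a (f * g) := by
  refine ENat.add_le_of_forall_natCast fun k l hk hl => ?_
  rw [natCast_le_zeroOrder_iff_isBigO hf] at hk
  rw [natCast_le_zeroOrder_iff_isBigO hg] at hl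
  rw [natCast_le_zeroOrder_iff_isBigO (hf.mul hg), extendZero_mul]
  simpa [pow_add] using hk.mul hl

theorem IsAnalyticFun.smul {f : Ω → ℂ} (hf : IsAnalyticFun f) (c : ℂ) : IsAnalyticFun (c • f) :=
  (IsAnalyticFun.const c).mul hf

theorem zeroOrder_smul {f : Ω → ℂ} (hf : IsAnalyticFun f) {c : ℂ} (hc : c ≠ 0) :
    zeroOrder a (c • f) = zeroOrder a f := by
  have key : ∀ {f : Ω → ℂ}, IsAnalyticFun f → ∀ c : ℂ, zeroOrder a f ≤ zeroOrder a (c • f) := by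
    intro f hf c
    refine ENat.forall_natCast_le_iff_le.1 fun k hk => ?_
    rw [natCast_le_zeroOrder_iff_isBigO hf] at hk
    rw [natCast_le_zeroOrder_iff_isBigO (hf.smul c), extendZero_smul]
    exact hk.const_smul_left c
  refine le_antisymm ?_ (key hf c)
  have := key (hf.smul c) c⁻¹
  rwa [smul_smul, inv_mul_cancel₀ hc, one_smul] at this

/-- The order of the zero at `a` is a valuation on every algebra of analytic functions. -/
noncomputable def zeroOrderValuation (a : Ω)
    (hΩ : IsPreconnected (Ω : Set (EuclideanSpace ℂ (Fin n)))) {R : Subalgebra ℂ (Ω → ℂ)}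
    (hR : ∀ r ∈ R, IsAnalyticFun r) : AnalyticValuation R where
  ord r := zeroOrder a (r : Ω → ℂ)
  ord_unit r hr := by
    obtain ⟨s, hs⟩ := hr.exists_right_inv
    by_contra h
    -- Positive order means vanishing at `a`, which evaluation of `r * s = 1` at `a` forbids.
    have h1 := (one_le_zeroOrder_iff (hR r r.2)).1 (Order.one_le_iff_ne_zero.2 h)
    have h2 := congrFun (congrArg Subtype.val hs) a
    simp [h1] at h2
  ord_eq_top_iff r := by
    rw [zeroOrder_eq_top_iff (hR r r.2) hΩ]
    simp
  ord_mul r s := le_zeroOrder_mul (hR r r.2) (hR s s.2)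
  ord_smul c r hc := zeroOrder_smul (hR r r.2) hc
  ord_add r s := le_zeroOrder_add (hR r r.2) (hR s s.2)

end ZeroOrder

/-! ### Invariant subspaces of valuation Hilbert modules -/

namespace HilbertModuleValuation

open Filter

variable {R : Type*} [CommRing R] [Algebra ℂ R] {vR : AnalyticValuation R}
  {H : Type*} [NormedAddCommGroup H] [InnerProductSpace ℂ H] [CompleteSpace H]
  [Module R H] [IsScalarTower ℂ R H] [ContinuousConstSMul R H]
  (v : HilbertModuleValuation vR H) {V : Submodule ℂ H}

theorem series_anti {j k : ℕ} (hjk : j ≤ k) : v.series V k ≤ v.series V j := fun _ hh =>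
  ⟨hh.1, (Nat.cast_le.2 hjk).trans hh.2⟩

theorem isClosed_setOf_le_ord (x : ℕ∞) : IsClosed {h | x ≤ v.ord h} :=
  upperSemicontinuous_iff_isClosed_preimage.1 v.ord_usc x

theorem isClosed_series (hV : IsClosed (V : Set H)) (k : ℕ) : IsClosed (v.series V k : Set H) :=
  hV.inter (v.isClosed_setOf_le_ord k)

theorem component_le (k : ℕ) : v.component V k ≤ V := fun _ hh => hh.1.1

/-- Subtracting the orthogonal projection onto the closed subspace `V_{k+1}` leaves the part in
`W_k`. -/
theorem exists_component_add (hV : IsClosed (V : Set H)) {k : ℕ} {h : H} (hh : h ∈ v.series V k) :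
    ∃ w ∈ v.component V k, h - w ∈ v.series V (k + 1) := by
  have : CompleteSpace (v.series V (k + 1)) := (v.isClosed_series hV (k + 1)).completeSpace_coe
  set p := (v.series V (k + 1)).starProjection h
  have hp : p ∈ v.series V (k + 1) := Submodule.starProjection_apply_mem _ _
  refine ⟨h - p, ⟨Submodule.sub_mem _ hh (v.series_anti k.le_succ hp), ?_⟩, by simpa using hp⟩
  exact Submodule.sub_starProjection_mem_orthogonal _

theorem inner_component_of_lt {j k : ℕ} (hjk : j < k) {w h : H} (hw : w ∈ v.component V j)
    (hh : h ∈ v.series V k) : inner ℂ w h = 0 :=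
  Submodule.inner_left_of_mem_orthogonal (v.series_anti hjk hh) hw.2

theorem proj_eq_zero {k : ℕ} {h : H} (hh : h ∈ v.series ⊤ (k + 1)) : v.proj k h = 0 := by
  rw [proj, Submodule.starProjection_apply_eq_zero_iff]
  intro w hw
  exact v.inner_component_of_lt k.lt_succ_self hw hh

/-- With `proj_eq_zero`, this says that on elements of order at least `k` the kernel of `P_k`
consists exactly of those of order at least `k + 1`: `P_k` sees the leading term. -/
theorem mem_series_of_proj_eq_zero {k : ℕ} {h : H} (hh : h ∈ v.series ⊤ k)
    (hp : v.proj k h = 0) : h ∈ v.series ⊤ (k + 1) := by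
  obtain ⟨w, hw, hsub⟩ := v.exists_component_add (V := ⊤) isClosed_univ hh
  have h1 : v.proj k w = w := Submodule.starProjection_eq_self_iff.2 hw
  have h2 : v.proj k (h - w) = 0 := v.proj_eq_zero hsub
  rw [map_sub, hp, h1, zero_sub, neg_eq_zero] at h2
  simpa [h2] using hsub

/-- Orthogonality to `W_k` pushes `h` from `V_k` into `V_{k+1}`, so the order of `h` is infinite.
Thus the components of a closed `V` have dense span in `V`. -/
theorem eq_zero_of_forall_component (hV : IsClosed (V : Set H)) {h : H} (hh : h ∈ V)
    (horth : ∀ k, ∀ w ∈ v.component V k, inner ℂ w h = 0) : h = 0 := by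
  have hk : ∀ k : ℕ, h ∈ v.series V k := by
    intro k
    induction k with
    | zero => exact ⟨hh, by simp⟩
    | succ k ih =>
      obtain ⟨w, hw, hsub⟩ := v.exists_component_add hV ih
      have h1 := horth k w hw
      have h2 := v.inner_component_of_lt k.lt_succ_self hw hsub
      rw [inner_sub_right, h1, zero_sub, neg_eq_zero, inner_self_eq_zero] at h2
      simpa [h2] using hsub
  exact (v.ord_eq_top_iff h).1 (ENat.eq_top_iff_forall_ge.2 fun k => (hk k).2)

/-- If all the components of `V` are mapped into `V` by `r`, so is `V`. -/
theorem smul_mem_of_forall_component (hV : IsClosed (V : Set H)) {r : R}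
    (hr : ∀ k, ∀ h ∈ v.component V k, r • h ∈ V) {h : H} (hh : h ∈ V) : r • h ∈ V := by
  set U : Submodule ℂ H := (⨆ k, v.component V k).topologicalClosure
  have hUV : U ≤ V := Submodule.topologicalClosure_minimal _ (iSup_le v.component_le) hV
  have hmem : h ∈ U := by
    have : CompleteSpace U := (Submodule.isClosed_topologicalClosure _).completeSpace_coe
    have hp : U.starProjection h ∈ U := Submodule.starProjection_apply_mem _ _
    have h0 : h - U.starProjection h = 0 := by
      refine v.eq_zero_of_forall_component hV (V.sub_mem hh (hUV hp)) fun k w hw => ?_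
      exact Submodule.sub_starProjection_mem_orthogonal h w
        (Submodule.le_topologicalClosure _ (Submodule.mem_iSup_of_mem k hw))
    rwa [sub_eq_zero.1 h0]
  -- Complex linearity of the action of `r` is not assumed; it follows from the scalar tower and
  -- commutativity of `R`.
  have hsmul : ∀ (c : ℂ) (x : H), r • (c • x) = c • (r • x) := fun c x => by
    rw [← smul_one_smul R c x, ← smul_one_smul R c (r • x), smul_smul, smul_smul, mul_comm]
  let T : H →L[ℂ] H :=
    { toFun := fun x => r • x
      map_add' := smul_add r
      map_smul' := hsmul
      cont := continuous_const_smul r }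
  have hclosed : IsClosed ((V.comap (T : H →ₗ[ℂ] H) : Submodule ℂ H) : Set H) :=
    hV.preimage T.continuous
  have hle : U ≤ V.comap (T : H →ₗ[ℂ] H) :=
    Submodule.topologicalClosure_minimal _ (iSup_le fun k x hx => hr k x hx) hclosed
  exact hle hmem

theorem IsR1Invariant.isR1Inner {v : HilbertModuleValuation vR H} (h : v.IsR1Invariant V) :
    v.IsR1Inner V := by
  intro k m x hx g hg r hr hm
  have hmem : r • x - g ∈ v.series V (m + 1) :=
    ⟨V.sub_mem (h r hr x hx.1.1) hg, by exact_mod_cast Order.add_one_le_of_lt hm⟩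
  exact fun w hw => v.inner_component_of_lt m.lt_succ_self hw hmem

theorem IsR1Invariant.hasFullProjection {v : HilbertModuleValuation vR H}
    (hV : IsClosed (V : Set H)) (h : v.IsR1Invariant V) : v.HasFullProjection V := by
  intro k m r hr x hx g hg hm
  obtain ⟨w, hw, hsub⟩ := v.exists_component_add hV
    (show r • x - g ∈ v.series V m from ⟨V.sub_mem (h r hr x hx.1.1) hg, hm⟩)
  refine ⟨w, hw, ?_⟩
  have := v.proj_eq_zero (k := m) (h := r • x - g - w) ⟨trivial, hsub.2⟩
  rwa [map_sub, sub_eq_zero] at this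

/-- The core of the Beurling-type theorem: `r • h` is expanded into an orthogonal series with terms
in the components of `V`. Full projection provides the next term, innerness keeps the partial sums
bounded by `‖r • h‖`, and semicontinuity of the order identifies the sum. -/
theorem smul_component_mem (hV : IsClosed (V : Set H)) (hinner : v.IsR1Inner V)
    (hproj : v.HasFullProjection V) {r : R} (hr : 1 ≤ vR.ord r) {k : ℕ} {h : H}
    (hh : h ∈ v.component V k) : r • h ∈ V := by
  set f := r • h with hf
  -- A `w` with the same image under `P_m` as `f - g` removes the leading term and raises the order.
  -- The premises sit inside the existential so that one choice function serves all `g`, with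
  -- default `0`.
  have hstep : ∀ (m : ℕ) (g : H), ∃ w, g ∈ V → (m : ℕ∞) ≤ v.ord (f - g) →
      w ∈ v.component V m ∧ ((m + 1 : ℕ) : ℕ∞) ≤ v.ord (f - (g + w)) := by
    intro m g
    by_cases hg : g ∈ V ∧ (m : ℕ∞) ≤ v.ord (f - g)
    · obtain ⟨w, hw, hpw⟩ := hproj k m r hr h hh g hg.1 hg.2
      refine ⟨w, fun _ _ => ⟨hw, ?_⟩⟩
      have h1 : f - g - w ∈ v.series ⊤ m :=
        Submodule.sub_mem _ ⟨trivial, hg.2⟩ ⟨trivial, hw.1.2⟩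
      have h2 := v.mem_series_of_proj_eq_zero h1 (by rw [map_sub, hf, hpw, sub_self])
      rw [← sub_sub]
      exact h2.2
    · exact ⟨0, fun h1 h2 => absurd ⟨h1, h2⟩ hg⟩
  choose c hc using hstep
  let g : ℕ → H := fun m => Nat.rec 0 (fun m g => g + c m g) m
  have hgs : ∀ m, g (m + 1) = g m + c m (g m) := fun m => rfl
  have hg : ∀ m, g m ∈ V ∧ (m : ℕ∞) ≤ v.ord (f - g m) := by
    intro m
    induction m with
    | zero => exact ⟨V.zero_mem, by simp⟩
    | succ m ih =>
      obtain ⟨h1, h2⟩ := hc m (g m) ih.1 ih.2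
      exact ⟨V.add_mem ih.1 (v.component_le m h1), h2⟩
  set w : ℕ → H := fun m => c m (g m)
  have hw : ∀ m, w m ∈ v.component V m := fun m => (hc m (g m) (hg m).1 (hg m).2).1
  have hsum : ∀ m, g m = ∑ i ∈ Finset.range m, w i := by
    intro m
    induction m with
    | zero => rfl
    | succ m ih => rw [hgs, Finset.sum_range_succ, ← ih]
  have horth : ∀ i j, i ≠ j → inner ℂ (w i) (w j) = 0 := by
    have key : ∀ i j, i < j → inner ℂ (w i) (w j) = 0 := fun i j hij =>
      v.inner_component_of_lt hij (hw i) (hw j).1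
    intro i j hij
    rcases hij.lt_or_gt with h1 | h1
    · exact key i j h1
    · exact inner_eq_zero_symm.1 (key j i h1)
  -- Innerness at every level `i < m`: the residual has order at least `m`, hence strictly more than
  -- `i`.
  have hres : ∀ m, ∀ i < m, inner ℂ (w i) (f - g m) = 0 := by
    intro m i hi
    have h1 : (i : ℕ∞) < v.ord (f - g m) := (Nat.cast_lt.2 hi).trans_le (hg m).2
    exact (hinner k i h hh (g m) (hg m).1 r hr h1) (w i) (hw i)
  have hpyth : ∀ s : Finset ℕ, ‖∑ i ∈ s, w i‖ ^ 2 = ∑ i ∈ s, ‖w i‖ ^ 2 := by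
    intro s
    induction s using Finset.induction_on with
    | empty => simp
    | insert i s hi ih =>
      have h1 : inner ℂ (w i) (∑ j ∈ s, w j) = 0 := by
        rw [inner_sum]
        exact Finset.sum_eq_zero fun j hj => horth i j fun h => hi (h ▸ hj)
      rw [Finset.sum_insert hi, Finset.sum_insert hi, ← ih]
      have h2 := norm_add_sq_eq_norm_sq_add_norm_sq_of_inner_eq_zero _ _ h1
      simpa [sq] using h2
  -- Bessel's inequality: the residual is orthogonal to the partial sum `g m`.
  have hnorm : ∀ m, ∑ i ∈ Finset.range m, ‖w i‖ ^ 2 ≤ ‖f‖ ^ 2 := by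
    intro m
    have h1 : ‖g m‖ ^ 2 = ∑ i ∈ Finset.range m, ‖w i‖ ^ 2 := by
      rw [hsum m, hpyth]
    have h2 : inner ℂ (g m) (f - g m) = 0 := by
      rw [hsum m, sum_inner]
      rw [← hsum m]
      exact Finset.sum_eq_zero fun i hi => hres m i (Finset.mem_range.1 hi)
    have h3 := norm_add_sq_eq_norm_sq_add_norm_sq_of_inner_eq_zero _ _ h2
    rw [add_sub_cancel] at h3
    rw [← h1]
    nlinarith [norm_nonneg (f - g m)]
  have hcauchy : CauchySeq g := by
    have hS : CauchySeq fun m => ∑ i ∈ Finset.range m, ‖w i‖ ^ 2 :=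
      (summable_of_sum_range_le (fun i => sq_nonneg ‖w i‖) hnorm).hasSum.tendsto_sum_nat.cauchySeq
    rw [Metric.cauchySeq_iff'] at hS ⊢
    intro ε hε
    obtain ⟨N, hN⟩ := hS (ε ^ 2) (by positivity)
    refine ⟨N, fun m hm => ?_⟩
    have h1 := hN m hm
    rw [Real.dist_eq, ← Finset.sum_Ico_eq_sub _ hm, ← hpyth, Finset.sum_Ico_eq_sub _ hm, ← hsum,
      ← hsum, abs_of_nonneg (by positivity)] at h1
    rw [dist_eq_norm]
    exact lt_of_pow_lt_pow_left₀ 2 hε.le h1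
  obtain ⟨G, hG⟩ := cauchySeq_tendsto_of_complete hcauchy
  have hGV : G ∈ V := hV.mem_of_tendsto hG (Eventually.of_forall fun m => (hg m).1)
  -- Each set of order at least `k` is closed and contains the residuals from index `k` on, hence
  -- also their limit.
  have htop : v.ord (f - G) = ⊤ := by
    refine ENat.eq_top_iff_forall_ge.2 fun k => ?_
    refine (v.isClosed_setOf_le_ord k).mem_of_tendsto (tendsto_const_nhds.sub hG) ?_
    filter_upwards [eventually_ge_atTop k] with m hm
    exact (Nat.cast_le.2 hm).trans (hg m).2
  rwa [sub_eq_zero.1 ((v.ord_eq_top_iff _).1 htop)]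

theorem isR1Invariant_iff (hV : IsClosed (V : Set H)) :
    v.IsR1Invariant V ↔ v.IsR1Inner V ∧ v.HasFullProjection V :=
  ⟨fun h => ⟨h.isR1Inner, h.hasFullProjection hV⟩, fun h _ hr _ hx =>
    v.smul_mem_of_forall_component hV
      (fun _ _ hy => v.smul_component_mem hV h.1 h.2 hr hy) hx⟩

theorem isR1Invariant_iff_component (hV : IsClosed (V : Set H)) :
    v.IsR1Invariant V ↔
      ∀ (k : ℕ) (r : R), 1 ≤ vR.ord r → ∀ h ∈ v.component V k, r • h ∈ V :=
  ⟨fun h k r hr x hx => h r hr x (v.component_le k hx), fun h r hr _ hx =>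
    v.smul_mem_of_forall_component hV (fun k y hy => h k r hr y hy) hx⟩

/-- The hypothesis says `R = ℂ + R₁`, and a complex subspace is already stable under scalars. -/
theorem isRInvariant_iff_isR1Invariant
    (hR : ∀ r : R, ∃ c : ℂ, 1 ≤ vR.ord (r - algebraMap ℂ R c)) :
    v.IsRInvariant V ↔ v.IsR1Invariant V := by
  refine ⟨fun h r _ => h r, fun h r x hx => ?_⟩
  obtain ⟨c, hc⟩ := hR r
  have h1 : r • x = (r - algebraMap ℂ R c) • x + c • x := by
    rw [sub_smul, algebraMap_smul, sub_add_cancel]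
  rw [h1]
  exact V.add_mem (h _ hc x hx) (V.smul_mem c hx)

end HilbertModuleValuation

/-! ### `H²` of a ball as an analytic Hilbert module -/

section HardyModule

open Filter Metric

variable {n : ℕ} [NeZero n] {a : EuclideanSpace ℂ (Fin n)} {ρ : ℝ} {hρ : 0 < ρ}

theorem toFun_mem_hardySpace (h : (hardyHilbertSpace a hρ).Elem) :
    h.toFun ∈ hardySpace (openBall a ρ) :=
  Subtype.property (p := fun f => f ∈ hardySpace (openBall a ρ)) h

theorem isAnalyticFun_toFun (h : (hardyHilbertSpace a hρ).Elem) : IsAnalyticFun h.toFun :=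
  (toFun_mem_hardySpace h).1

theorem hardyElem_ext {f g : (hardyHilbertSpace a hρ).Elem} (h : f.toFun = g.toFun) : f = g :=
  Subtype.ext h

theorem toFun_add (f g : (hardyHilbertSpace a hρ).Elem) : (f + g).toFun = f.toFun + g.toFun := rfl

theorem toFun_sub (f g : (hardyHilbertSpace a hρ).Elem) : (f - g).toFun = f.toFun - g.toFun := rfl

theorem toFun_smul (c : ℂ) (f : (hardyHilbertSpace a hρ).Elem) : (c • f).toFun = c • f.toFun := rfl

theorem toFun_zero : (0 : (hardyHilbertSpace a hρ).Elem).toFun = 0 := rfl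

/-- Norm convergence in `H²` controls uniform convergence on compact sets. -/
theorem exists_norm_extendZero_le {K : Set (EuclideanSpace ℂ (Fin n))} (hK : IsCompact K)
    (hKs : K ⊆ ball a ρ) : ∃ M : ℝ, 0 ≤ M ∧ ∀ h : (hardyHilbertSpace a hρ).Elem, ∀ z ∈ K,
      ‖extendZero h.toFun z‖ ≤ M * ‖h‖ := by
  obtain ⟨M, hM⟩ := hK.bddAbove_image ((continuousOn_evaluationBound hρ).mono hKs)
  refine ⟨√|M|, Real.sqrt_nonneg _, fun h z hz => ?_⟩
  refine le_of_sq_le_sq ?_ (by positivity)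
  rw [mul_pow, Real.sq_sqrt (abs_nonneg _), hardyHilbertSpace_norm_sq,
    extendZero_of_mem (Ω := openBall a ρ) _ (hKs hz)]
  exact (norm_sq_le_evaluationBound_mul hρ h ⟨z, hKs hz⟩).trans (mul_le_mul_of_nonneg_right
    ((hM (Set.mem_image_of_mem _ hz)).trans (le_abs_self M)) ((hardyCore a hρ).re_inner_nonneg h))

/-- The Taylor coefficients at the center are continuous on `H²`. -/
theorem continuous_iteratedFDeriv_center (j : ℕ) (w : EuclideanSpace ℂ (Fin n)) :
    Continuous fun h : (hardyHilbertSpace a hρ).Elem =>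
      iteratedFDeriv ℂ j (extendZero h.toFun) a (fun _ => w) := by
  have hcd : ∀ h : (hardyHilbertSpace a hρ).Elem, ∀ k : ℕ,
      ContDiffOn ℂ k (extendZero h.toFun) (ball a ρ) := fun h k =>
    (isAnalyticFun_toFun h).analyticOnNhd_extendZero.contDiffOn isOpen_ball.uniqueDiffOn
  have hcda : ∀ h : (hardyHilbertSpace a hρ).Elem, ContDiffAt ℂ j (extendZero h.toFun) a :=
    fun h => (hcd h j).contDiffAt (isOpen_ball.mem_nhds (mem_ball_self hρ))
  let T : (hardyHilbertSpace a hρ).Elem →ₗ[ℂ] ℂ :=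
    { toFun := fun h => iteratedFDeriv ℂ j (extendZero h.toFun) a (fun _ => w)
      map_add' := fun f g => by
        rw [toFun_add, extendZero_add, iteratedFDeriv_add_apply (hcda f) (hcda g)]; rfl
      map_smul' := fun c f => by
        rw [toFun_smul, extendZero_smul, iteratedFDeriv_const_smul_apply (hcda f)]; rfl }
  -- Chosen so that `j` Cauchy steps of size `δ` stay in a closed ball of radius less than `ρ`,
  -- including `j = 0`.
  set δ : ℝ := ρ / (2 * (j + 1)) with hδdef
  have hδ : 0 < δ := by positivity
  have hjδ : j * δ < ρ := by
    rw [hδdef, mul_div_assoc', div_lt_iff₀ (by positivity)]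
    nlinarith [(Nat.cast_nonneg j : (0 : ℝ) ≤ j)]
  have hsub : closedBall a (j * δ) ⊆ ball a ρ := closedBall_subset_ball hjδ
  obtain ⟨M, hM0, hM⟩ := exists_norm_extendZero_le (hρ := hρ) (isCompact_closedBall a (j * δ)) hsub
  refine (T.mkContinuous (M / δ ^ j * ‖w‖ ^ j) fun h => ?_).continuous
  have h1 := norm_iteratedFDeriv_le_of_closedBall_subset isOpen_ball (hcd h) hδ j hsub (hM h)
  have h2 := (iteratedFDeriv ℂ j (extendZero h.toFun) a).le_opNorm (fun _ => w)
  rw [Finset.prod_const, Finset.card_univ, Fintype.card_fin] at h2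
  refine h2.trans ((mul_le_mul_of_nonneg_right h1 (by positivity)).trans (le_of_eq ?_))
  ring

/-- The set is an intersection of zero sets of Taylor coefficients, which are continuous on `H²`.
This is upper semicontinuity of the order. -/
theorem isClosed_le_zeroOrder (x : ℕ∞) :
    IsClosed {h : (hardyHilbertSpace a hρ).Elem |
      x ≤ zeroOrder (⟨a, mem_ball_self hρ⟩ : openBall a ρ) h.toFun} := by
  have : {h : (hardyHilbertSpace a hρ).Elem |
      x ≤ zeroOrder (⟨a, mem_ball_self hρ⟩ : openBall a ρ) h.toFun} =
      ⋂ k ∈ {k : ℕ | (k : ℕ∞) ≤ x}, ⋂ j ∈ {j : ℕ | j < k}, ⋂ w,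
        {h | iteratedFDeriv ℂ j (extendZero h.toFun) a (fun _ => w) = 0} := by
    ext h
    simp only [Set.mem_iInter]
    change x ≤ _ ↔ ∀ k : ℕ, (k : ℕ∞) ≤ x → ∀ j, j < k → ∀ w,
      iteratedFDeriv ℂ j (extendZero h.toFun) a (fun _ => w) = 0
    rw [← ENat.forall_natCast_le_iff_le]
    exact forall₂_congr fun k _ => natCast_le_zeroOrder_iff (isAnalyticFun_toFun h) k
  rw [this]
  exact isClosed_biInter fun k _ => isClosed_biInter fun j _ => isClosed_iInter fun w =>
    isClosed_eq (continuous_iteratedFDeriv_center j w) continuous_const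

theorem quadraticMean_mul_le {r h : openBall a ρ → ℂ} (hr : IsAnalyticFun r)
    (hh : IsAnalyticFun h) {C : ℝ} (hC : ∀ z, ‖r z‖ ≤ C) {t : ℝ} (ht : t ∈ Set.Ioo 0 ρ) :
    quadraticMean a (extendZero (r * h)) t ≤ C ^ 2 * quadraticMean a (extendZero h) t := by
  have ch := hh.analyticOnNhd_extendZero.continuousOn.continuous_dilate_sphere ht
  have crh := (hr.mul hh).analyticOnNhd_extendZero.continuousOn.continuous_dilate_sphere ht
  rw [quadraticMean, quadraticMean, ← MeasureTheory.integral_const_mul]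
  refine MeasureTheory.integral_mono (integrable_sphere_of_continuous (crh.norm.pow 2))
    ((integrable_sphere_of_continuous (ch.norm.pow 2)).const_mul _) fun z => ?_
  have hz : a + t • (z : EuclideanSpace ℂ (Fin n)) ∈ openBall a ρ := add_smul_sphere_mem_ball ht z
  simp only [extendZero_of_mem _ hz, Pi.mul_apply, norm_mul, mul_pow]
  gcongr
  exact hC _

theorem mul_mem_hardySpace (hρ : 0 < ρ) {r h : openBall a ρ → ℂ}
    (hr : r ∈ boundedAnalyticAlgebra (openBall a ρ)) (hh : h ∈ hardySpace (openBall a ρ)) :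
    r * h ∈ hardySpace (openBall a ρ) := by
  obtain ⟨hra, C, hC⟩ := hr
  obtain ⟨hha, D, hD⟩ := (mem_hardySpace_openBall_iff hρ).1 hh
  exact (mem_hardySpace_openBall_iff hρ).2 ⟨hra.mul hha, C ^ 2 * D, fun t ht =>
    (quadraticMean_mul_le hra hha hC ht).trans
      (mul_le_mul_of_nonneg_left (hD t ht) (sq_nonneg C))⟩

variable {R : Subalgebra ℂ (openBall a ρ → ℂ)}

/-- `H²` of the ball as a module over an algebra of bounded analytic functions, under pointwise
multiplication. -/
@[reducible] noncomputable def hardyModule (hρ : 0 < ρ)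
    (hR : R ≤ boundedAnalyticAlgebra (openBall a ρ)) : Module R (hardyHilbertSpace a hρ).Elem where
  smul r h := (⟨(r : openBall a ρ → ℂ) * h.toFun,
    mul_mem_hardySpace hρ (hR r.2) (toFun_mem_hardySpace h)⟩ : hardySpace (openBall a ρ))
  one_smul _ := hardyElem_ext (one_mul _)
  mul_smul _ _ _ := hardyElem_ext (mul_assoc _ _ _)
  smul_zero _ := hardyElem_ext (mul_zero _)
  smul_add _ _ _ := hardyElem_ext (mul_add _ _ _)
  add_smul _ _ _ := hardyElem_ext (add_mul _ _ _)
  zero_smul _ := hardyElem_ext (zero_mul _)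

theorem hardyModule_smul_toFun (hR : R ≤ boundedAnalyticAlgebra (openBall a ρ)) (r : R)
    (h : (hardyHilbertSpace a hρ).Elem) :
    letI := hardyModule hρ hR
    (r • h).toFun = (r : openBall a ρ → ℂ) * h.toFun := rfl

theorem hardyModule_isScalarTower (hR : R ≤ boundedAnalyticAlgebra (openBall a ρ)) :
    letI := hardyModule hρ hR
    IsScalarTower ℂ R (hardyHilbertSpace a hρ).Elem := by
  let _ := hardyModule hρ hR
  exact ⟨fun c r h => hardyElem_ext (smul_mul_assoc c (r : openBall a ρ → ℂ) h.toFun)⟩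

theorem hardyModule_continuousConstSMul (hR : R ≤ boundedAnalyticAlgebra (openBall a ρ)) :
    letI := hardyModule hρ hR
    ContinuousConstSMul R (hardyHilbertSpace a hρ).Elem := by
  let _ := hardyModule hρ hR
  refine ⟨fun r => ?_⟩
  obtain ⟨hra, C, hC⟩ := hR r.2
  let T : (hardyHilbertSpace a hρ).Elem →+ (hardyHilbertSpace a hρ).Elem :=
    { toFun := fun h => r • h, map_zero' := smul_zero r, map_add' := smul_add r }
  refine AddMonoidHomClass.continuous_of_bound T |C| fun h => ?_
  refine le_of_sq_le_sq ?_ (by positivity)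
  rw [mul_pow, sq_abs, hardyHilbertSpace_norm_sq, hardyHilbertSpace_norm_sq]
  refine inner_self_le_of_quadraticMean_le hρ _ fun t ht => ?_
  exact (quadraticMean_mul_le hra (isAnalyticFun_toFun h) hC ht).trans
    (mul_le_mul_of_nonneg_left (quadraticMean_le_inner_self hρ h ht) (sq_nonneg C))

/-- The order of the zero at the center is a Hilbert module valuation on `H²` of the ball. -/
noncomputable def hardyValuation (hR : ∀ r ∈ R, IsAnalyticFun r)
    [Module R (hardyHilbertSpace a hρ).Elem] [IsScalarTower ℂ R (hardyHilbertSpace a hρ).Elem]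
    [ContinuousConstSMul R (hardyHilbertSpace a hρ).Elem]
    (hsmul : ∀ (r : R) (h : (hardyHilbertSpace a hρ).Elem),
      (r • h).toFun = (r : openBall a ρ → ℂ) * h.toFun) :
    HilbertModuleValuation (zeroOrderValuation (⟨a, mem_ball_self hρ⟩ : openBall a ρ)
      (convex_ball a ρ).isPreconnected hR) (hardyHilbertSpace a hρ).Elem where
  ord h := zeroOrder (⟨a, mem_ball_self hρ⟩ : openBall a ρ) h.toFun
  ord_eq_top_iff h := by
    rw [zeroOrder_eq_top_iff (isAnalyticFun_toFun h) (convex_ball a ρ).isPreconnected]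
    exact ⟨fun h0 => hardyElem_ext (h0.trans toFun_zero.symm), fun h0 => h0 ▸ toFun_zero⟩
  ord_module_smul r h := by
    rw [hsmul]
    exact le_zeroOrder_mul (hR r r.2) (isAnalyticFun_toFun h)
  ord_smul c h hc := by
    rw [toFun_smul]
    exact zeroOrder_smul (isAnalyticFun_toFun h) hc
  ord_add f g := by
    rw [toFun_add]
    exact le_zeroOrder_add (isAnalyticFun_toFun f) (isAnalyticFun_toFun g)
  ord_usc := upperSemicontinuous_iff_isClosed_preimage.2 fun x => isClosed_le_zeroOrder x

theorem tendstoUniformlyOn_toFun_of_tendsto {f : ℕ → (hardyHilbertSpace a hρ).Elem}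
    {g : (hardyHilbertSpace a hρ).Elem} (hfg : Tendsto f atTop (𝓝 g))
    {K : Set (openBall a ρ)} (hK : IsCompact K) :
    TendstoUniformlyOn (fun j => (f j).toFun) g.toFun atTop K := by
  obtain ⟨M, hM0, hM⟩ := exists_norm_extendZero_le (hρ := hρ)
    (hK.image continuous_subtype_val) (by rintro _ ⟨z, -, rfl⟩; exact z.2)
  have hlim : Tendsto (fun j => M * ‖f j - g‖) atTop (𝓝 0) := by
    have := (tendsto_iff_norm_sub_tendsto_zero.1 hfg).const_mul M
    rwa [mul_zero] at this
  rw [Metric.tendstoUniformlyOn_iff]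
  intro ε hε
  filter_upwards [hlim.eventually_lt_const hε] with j hj z hz
  have := hM (f j - g) z (Set.mem_image_of_mem _ hz)
  rw [extendZero_apply, toFun_sub] at this
  rw [dist_comm, dist_eq_norm]
  exact this.trans_lt hj

omit [NeZero n] in
-- The generators, the coordinate functions, are bounded by `‖a‖ + ρ`. Both choices of `R` thus
-- become subalgebras of `H^∞` and are treated together.
theorem polynomialAlgebra_le_boundedAnalyticAlgebra :
    polynomialAlgebra (openBall a ρ) ≤ boundedAnalyticAlgebra (openBall a ρ) := by
  rw [polynomialAlgebra, ← Algebra.adjoin_range_eq_range_aeval, Algebra.adjoin_le_iff]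
  rintro _ ⟨i, rfl⟩
  refine ⟨isAnalyticFun_of_eqOn (F := fun z => z i)
    ((EuclideanSpace.proj i : EuclideanSpace ℂ (Fin n) →L[ℂ] ℂ).analyticOnNhd _) fun z => rfl,
    ‖a‖ + ρ, fun z => ?_⟩
  refine (PiLp.norm_apply_le (z : EuclideanSpace ℂ (Fin n)) i).trans ?_
  have hz : ‖(z : EuclideanSpace ℂ (Fin n)) - a‖ < ρ := mem_ball_iff_norm.1 z.2
  have := norm_sub_norm_le (z : EuclideanSpace ℂ (Fin n)) a
  linarith

end HardyModule

/-! ### Assembly of the main theorem. -/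

theorem theorem14p4 (n : ℕ) (hn : 1 ≤ n) (a : EuclideanSpace ℂ (Fin n)) (ρ : ℝ) (hρ : 0 < ρ) :
    -- every `|h|²`, `h ∈ H²`, has a least harmonic majorant
    (∀ h ∈ hardySpace (openBall a ρ), ∃ u, IsLeastHarmonicMajorant h u) ∧
    -- `H²` is a Hilbert space for the norm `‖h‖² = u(a)`
    ∃ 𝓗 : FunctionHilbertSpace (openBall a ρ),
      𝓗.carrier = hardySpace (openBall a ρ) ∧
      (∀ (h : 𝓗.Elem) (u : EuclideanSpace ℂ (Fin n) → ℝ),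
        IsLeastHarmonicMajorant h.toFun u → ‖h‖ ^ 2 = u a) ∧
      ∀ R : Subalgebra ℂ (openBall a ρ → ℂ),
        R = polynomialAlgebra (openBall a ρ) ∨ R = boundedAnalyticAlgebra (openBall a ρ) →
        -- `H²` is an analytic Hilbert module over the analytic algebra `R`
        ∃ (_ : Module R 𝓗.Elem) (_ : IsScalarTower ℂ R 𝓗.Elem)
          (_ : ContinuousConstSMul R 𝓗.Elem) (vR : AnalyticValuation R)
          (v : HilbertModuleValuation vR 𝓗.Elem),
          IsAnalyticHilbertModule (⟨a, Metric.mem_ball_self hρ⟩ : openBall a ρ) vR v ∧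
          -- the abstract Beurling theorem and its corollaries hold for `H²` over `R`
          ∀ V : Submodule ℂ 𝓗.Elem, IsClosed (V : Set 𝓗.Elem) →
            (v.IsR1Invariant V ↔ v.IsR1Inner V ∧ v.HasFullProjection V) ∧
            (v.IsR1Invariant V ↔
              ∀ (k : ℕ) (r : R), 1 ≤ vR.ord r → ∀ h ∈ v.component V k, r • h ∈ V) ∧
            (v.IsRInvariant V ↔ v.IsR1Inner V ∧ v.HasFullProjection V) := by
  have : NeZero n := ⟨Nat.one_le_iff_ne_zero.1 hn⟩
  refine ⟨fun h hh => ?_, hardyHilbertSpace a hρ, rfl, fun h u hu => ?_, fun R hRor => ?_⟩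
  · obtain ⟨u, hu, -⟩ := exists_isLeastHarmonicMajorant hρ hh
    exact ⟨u, hu⟩
  · rw [hardyHilbertSpace_norm_sq]
    exact hardyCore_inner_self_re hρ h hu
  have hR : R ≤ boundedAnalyticAlgebra (openBall a ρ) := by
    rcases hRor with rfl | rfl
    · exact polynomialAlgebra_le_boundedAnalyticAlgebra
    · exact le_rfl
  have hRa : ∀ r ∈ R, IsAnalyticFun r := fun r hr => (hR hr).1
  let _ := hardyModule hρ hR
  have hst := hardyModule_isScalarTower (hρ := hρ) hR
  have hcs := hardyModule_continuousConstSMul (hρ := hρ) hR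
  let v := hardyValuation (hρ := hρ) hRa (hardyModule_smul_toFun hR)
  refine ⟨inferInstance, hst, hcs, _, v, ?_, fun V hV => ?_⟩
  · exact
      { analytic_algebra := fun r => hRa r r.2
        analytic_space := isAnalyticFun_toFun
        ord_algebra := fun r => rfl
        ord_space := fun h => rfl
        smul_pointwise := fun r h z => congrFun (hardyModule_smul_toFun hR r h) z
        -- Evaluation bounds hold on every compact subset of the ball, so the whole ball serves as
        -- the neighborhood.
        locally_compact_convergence := ⟨Set.univ, isOpen_univ, trivial,
          fun f g hfg K _ hK => tendstoUniformlyOn_toFun_of_tendsto hfg hK⟩ }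
  · have hinv := v.isR1Invariant_iff hV
    refine ⟨hinv, v.isR1Invariant_iff_component hV, ?_⟩
    rw [v.isRInvariant_iff_isR1Invariant fun r => ?_, hinv]
    set z₀ : openBall a ρ := ⟨a, Metric.mem_ball_self hρ⟩
    -- The scalar is the value `r(a)`: `r - r(a)` vanishes at the center, hence has order at least
    -- `1`.
    refine ⟨(r : openBall a ρ → ℂ) z₀, ?_⟩
    refine (one_le_zeroOrder_iff (hRa _ (Subtype.property _))).2 ?_
    exact sub_self _
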